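/- Throughout, $\log=\log_2$ and information is measured in bits. **Setting.** Before a database is drawn, an encoder $A$ and a decoder $B$ share a resource. Each share has a classical part (with values in an arbitrary measurable space) and a finite-dimensional quantum part: the classical parts $(r,s)$ have an arbitrary joint law, given by the law of $s$ and the conditional law of $r$ given $s$, and given $(r,s)$ the quantum parts are in a density operator $\tau_{r,s}$. A database $\vec a\in\{0,1\}^N$ is drawn from a law $p$, independently of the resource. The encoder, knowing $\vec a$ and $r$, measures the quantum part of its share with a positive operator valued measure (which may include local randomness) and feeds the outcome $U$ into the interface. The interface is a noise channel $U\mapsto H$ together with a constraint on the law of $U$. It outputs the classical representation $H$. Writing $B$ for the decoder's share, define the effective capacity $$C_H:=\sup I(\vec a:H\mid B),$$ the supremum being over all $N$, all laws $p$ on $\{0,1\}^N$, and all encoders that satisfy the constraint. Here the conditional mutual information given a quantum system $Q$ is $I(X:Y\mid Q)=S(XQ)+S(YQ)-S(Q)-S(XYQ)$ with $S$ the von Neumann entropy for finite-valued classical $X,Y$; one averages over the classical part of $B$, and for general $H$ one takes the supremum over finite measurable quantizations of $H$. **Proposition.** For every such resource: 1. If $H$ takes values in a finite alphabet $\mathcal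 H$, then $C_H\le\log|\mathcal H|$. 2. If $H$ is a $d$-coordinate register quantized to $q$ bits per coordinate (the $i$-th coordinate takes at most $2^q$ values), then $C_H\le dq$. 3. Let $H=U+Z$ be a real additive white Gaussian noise interface with $U\in\mathbb R^d$ and $Z\sim\mathcal N(0,\sigma^2 I_d)$ independent of everything else, $\sigma>0$, under the average power constraint $\mathbb E\|U\|^2\le dP$ with $P\ge 0$. Then $C_H\le\frac d2\log\!\left(1+\frac{P}{\sigma^2}\right)$. 4. If $H=U\in\mathbb R^d$, $d\ge1$, is an ideal real-valued register, without noise and without any constraint on the encoder, then $C_H=\infty$: no finite number is a capacity certificate. -/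

import Mathlib

open MeasureTheory ProbabilityTheory
open scoped ENNReal Kronecker ComplexOrder

noncomputable section

namespace NeuralIC

/-! ### Entropies of classical-quantum states, in bits -/

/-- The entropy functional `-tr (ρ log₂ ρ)` of a positive semidefinite matrix `ρ`, which need not
be normalized (`Real.negMulLog x = -x * log x`, with value `0` at `0`). -/
def entropy {β : Type*} [Fintype β] [DecidableEq β] (ρ : Matrix β β ℂ) : ℝ :=
  (cfc Real.negMulLog ρ).trace.re / Real.log 2

/-- Von Neumann entropy of a state of a classical register `x` together with a quantum system.
The density matrix is block diagonal with blocks `ω x`, so that its entropy is the sum of the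
contributions of the blocks. -/
def cqEntropy {X β : Type*} [Fintype X] [Fintype β] [DecidableEq β]
    (ω : X → Matrix β β ℂ) : ℝ :=
  ∑ x, entropy (ω x)

/-- Conditional mutual information `I(X : Y | Q) = S(XQ) + S(YQ) - S(Q) - S(XYQ)` in bits of
classical registers `X`, `Y` of finite alphabets and a quantum system `Q`. The matrix `ω x y` is
the subnormalized state of `Q` on the event that the registers hold `x` and `y`. -/
def condMutualInfo {X Y β : Type*} [Fintype X] [Fintype Y] [Fintype β] [DecidableEq β]
    (ω : X → Y → Matrix β β ℂ) : ℝ :=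
  cqEntropy (fun x => ∑ y, ω x y) + cqEntropy (fun y => ∑ x, ω x y)
    - entropy (∑ x, ∑ y, ω x y) - cqEntropy (fun z : X × Y => ω z.1 z.2)

/-- Partial trace over the first factor. -/
def partialTraceLeft {α β : Type*} [Fintype α] (τ : Matrix (α × β) (α × β) ℂ) : Matrix β β ℂ :=
  Matrix.of fun j j' => ∑ i, τ (i, j) (i, j')

/-! ### Pre-established resources -/

/-- A pre-established resource shared by the encoder (side `A`) and the decoder (side `B`). Each
share consists of a classical part, with values in an arbitrary measurable space `ΩA` or `ΩB`, and
of a finite-dimensional quantum part, with basis indexed by `α` or `β`. The joint law of the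
classical parts is given by the law of the part of `B` and the conditional law of the part of `A`;
`state r s` is the density matrix of the quantum parts when the classical parts are `r` and `s`.
Arbitrary classical shared or correlated randomness is the case in which `α` and `β` have one
element, and a bipartite quantum state is the case in which `ΩA` and `ΩB` have one element. -/
structure Resource (ΩA ΩB α β : Type*) [MeasurableSpace ΩA] [MeasurableSpace ΩB]
    [Fintype α] [Fintype β] where
  /-- law of the classical part of the share of the decoder -/
  lawB : Measure ΩB
  isProbabilityMeasure_lawB : IsProbabilityMeasure lawB
  /-- conditional law of the classical part of the share of the encoder -/
  lawA : Kernel ΩB ΩA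
  isMarkovKernel_lawA : IsMarkovKernel lawA
  /-- joint state of the quantum parts of the two shares -/
  state : ΩA → ΩB → Matrix (α × β) (α × β) ℂ
  measurable_state : ∀ x y, Measurable fun z : ΩA × ΩB => state z.1 z.2 x y
  posSemidef_state : ∀ r s, (state r s).PosSemidef
  trace_state : ∀ r s, (state r s).trace = 1

/-! ### Encoders and interface models -/

/-- An encoder of databases of `N` bits that has access to the share of side `A`. Given the
database `a` and the classical part `r` of its share, it measures the quantum part of its share
with a positive operator valued measure and writes the outcome `u : U` into the interface.
The operator valued measure is given by its density, `S ↦ ∫ u ∈ S, effect a r u ∂(base a r)`; on a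
finite-dimensional space every positive operator valued measure has this form, for instance with
`base a r` its trace. Local randomness of the encoder is included, since mixtures of operator
valued measures are operator valued measures. If `α` has one element, this is a Markov kernel
from `ΩA` to `U` for each `a`. -/
structure Encoder (ΩA α U : Type*) [MeasurableSpace ΩA] [Fintype α] [DecidableEq α]
    [MeasurableSpace U] (N : ℕ) where
  base : (Fin N → Bool) → Kernel ΩA U
  isFiniteKernel_base : ∀ a, IsFiniteKernel (base a)
  effect : (Fin N → Bool) → ΩA → U → Matrix α α ℂ
  measurable_effect : ∀ a i j, Measurable fun z : ΩA × U => effect a z.1 z.2 i j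
  posSemidef_effect : ∀ a r u, (effect a r u).PosSemidef
  integral_effect : ∀ a r i j,
    ∫ u, effect a r u i j ∂(base a r) = (1 : Matrix α α ℂ) i j

/-- A physical model of an interface: the encoder supplies an input in `U`, a memoryless noise
mechanism `channel` turns it into the representation with values in `H`, and the law of the input
has to obey the physical constraint `admissible`. -/
structure Interface (U H : Type*) [MeasurableSpace U] [MeasurableSpace H] where
  channel : Kernel U H
  isMarkovKernel_channel : IsMarkovKernel channel
  admissible : Set (Measure U)

section Experiment

variable {ΩA ΩB α β U H : Type*} [MeasurableSpace ΩA] [MeasurableSpace ΩB]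
  [Fintype α] [DecidableEq α] [Fintype β] [DecidableEq β]
  [MeasurableSpace U] [MeasurableSpace H] {N : ℕ}

/-- The unnormalized state `tr_A ((effect a r u ⊗ 1) τ)` in which the outcome `u` of the encoder
leaves the quantum part of the share of the decoder. -/
def postState (R : Resource ΩA ΩB α β) (E : Encoder ΩA α U N) (a : Fin N → Bool)
    (r : ΩA) (s : ΩB) (u : U) : Matrix β β ℂ :=
  partialTraceLeft ((E.effect a r u ⊗ₖ (1 : Matrix β β ℂ)) * R.state r s)

/-- The law of the input of the interface if the database has law `p` and is independent of the
resource. By Born's rule, for given `a`, `r`, `s` the input has density `tr (postState R E a r s u)`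
with respect to `base a r`. -/
def inputLaw (R : Resource ΩA ΩB α β) (p : PMF (Fin N → Bool)) (E : Encoder ΩA α U N) :
    Measure U :=
  ∑ a, p a • (((R.lawB ⊗ₘ R.lawA) ⊗ₘ (E.base a).prodMkLeft ΩB).withDensity
    fun z => ENNReal.ofReal (postState R E a z.1.2 z.1.1 z.2).trace.re).snd

/-- Given the database `a` and the classical part `s` of the share of the decoder, the subnormalized
state of the quantum part of the share of the decoder on the event that the representation lies
in `S`. -/
def outcomeState (M : Interface U H) (R : Resource ΩA ΩB α β) (E : Encoder ΩA α U N)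
    (a : Fin N → Bool) (s : ΩB) (S : Set H) : Matrix β β ℂ :=
  Matrix.of fun j j' => ∫ r, ∫ u,
    ((M.channel u).real S : ℂ) * postState R E a r s u j j' ∂(E.base a r) ∂(R.lawA s)

/-- The conditional mutual information `I(a : H | B)` in bits between the database `a`, with law `p`
and independent of the resource, and the representation, given the share `B` of the decoder.
One averages over the classical part `s` of `B` the conditional mutual information given the
quantum part of `B`; for a representation with values in a general measurable space one takes the
supremum over its measurable quantizations with finitely many values. -/
def interfaceInfo (M : Interface U H) (R : Resource ΩA ΩB α β) (p : PMF (Fin N → Bool))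
    (E : Encoder ΩA α U N) : ℝ≥0∞ :=
  ⨆ (k : ℕ) (f : H → Fin k) (_ : Measurable f),
    ∫⁻ s, ENNReal.ofReal (condMutualInfo fun (a : Fin N → Bool) (y : Fin k) =>
      ((p a).toReal : ℂ) • outcomeState M R E a s (f ⁻¹' {y})) ∂(R.lawB)

/-- The effective capacity of an interface model in the presence of the resource `R`: the supremum
of `I(a : H | B)` over all databases (of any number of bits and any law, independent of the
resource) and over all encoders that obey the physical constraint. -/
def capacity (M : Interface U H) (R : Resource ΩA ΩB α β) : ℝ≥0∞ :=
  ⨆ (N : ℕ) (p : PMF (Fin N → Bool)) (E : Encoder ΩA α U N)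
    (_ : inputLaw R p E ∈ M.admissible), interfaceInfo M R p E

end Experiment

/-! ### The standard interface models -/

/-- The law `𝒩(0, σ² I_d)` of a Gaussian noise vector. -/
def gaussianNoise (d : ℕ) (σ : ℝ) : Measure (Fin d → ℝ) :=
  Measure.pi fun _ => gaussianReal 0 (σ ^ 2).toNNReal

instance (d : ℕ) (σ : ℝ) : IsProbabilityMeasure (gaussianNoise d σ) := by
  unfold gaussianNoise
  infer_instance

/-- The real additive white Gaussian noise interface `H = U + Z`, where `Z` has law `𝒩(0, σ² I_d)`
and is independent of everything else, with the average power constraint `𝔼 ‖U‖² ≤ d P`. -/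
def awgn (d : ℕ) (P σ : ℝ) : Interface (Fin d → ℝ) (Fin d → ℝ) where
  channel := (Kernel.id ×ₖ Kernel.const (Fin d → ℝ) (gaussianNoise d σ)).map
    fun z => z.1 + z.2
  isMarkovKernel_channel := Kernel.IsMarkovKernel.map _ (by fun_prop)
  admissible := {μ | ∫⁻ u, ENNReal.ofReal (∑ i, u i ^ 2) ∂μ ≤ ENNReal.ofReal (d * P)}

/-- The ideal register of `d` real coordinates: the representation is the input itself, without
noise, and every input law is allowed. -/
def realRegister (d : ℕ) : Interface (Fin d → ℝ) (Fin d → ℝ) where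
  channel := Kernel.id
  isMarkovKernel_channel := inferInstance
  admissible := Set.univ

end NeuralIC

end

/-! All upper bounds come from one estimate: the information is at most the mean, over the law of
the input `U`, of the relative entropy of the quantized output law given `U` with respect to any
fixed reference law `ν`. The chain rule writes I(X:Y|Q) as S(Y|Q) minus the average over x of S(Y|Q,
X = x). Klein's inequality bounds S(Y|Q) by the cross entropy of Y with respect to `ν`
(`sum_trace_negMulLog_sub_le`).

The other term is a sum of relative entropies of A = ∫ kΦ with respect to B = ∫ Φ, where Φ is the
unnormalized state left by the encoder's measurement and k is a transition probability of the noise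
channel. Data processing bounds each by its classical value ∫ k log k tr Φ
(`relEntropy_matrixIntegral_le`). This holds because the relative entropy is an integral over t in
(0,1) of quadratic divergences, and each divergence has a variational form that is linear in (A, B)
once its witness is fixed. Linearity moves the form under the integral over z, where A and B become
the proportional matrices k(z)Φ(z) and Φ(z), and a completed square gives the scalar value. Adding
the two bounds gives `condMutualInfo_mul_log_two_le`. The resource enters only through Φ, so it
cannot raise the bound.

The choice of `ν` does the rest. For a finite alphabet it is uniform on the attained quantized
values. For Gaussian noise it is the quantization of 𝒩(0, (σ² + P)I): the divergence is affine in
‖u‖², so the power constraint controls its mean. The ideal register has no such bound, since one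
real coordinate already stores the index of an arbitrarily long database. -/

namespace NeuralIC

open Matrix

/-! ### Spectral calculus for pairs of Hermitian matrices; Klein's inequality -/

section Spectral

variable {n : Type*} [Fintype n] [DecidableEq n]

/-- Matrix of the inner products of the eigenvectors of `A` with those of `B`. -/
noncomputable def eigenOverlap {A B : Matrix n n ℂ} (hA : A.IsHermitian) (hB : B.IsHermitian) :
    Matrix n n ℂ :=
  (hA.eigenvectorUnitary : Matrix n n ℂ)ᴴ * (hB.eigenvectorUnitary : Matrix n n ℂ)

theorem cfc_eq_mul_diagonal_mul {A : Matrix n n ℂ} (hA : A.IsHermitian) (f : ℝ → ℝ) :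
    cfc f A = (hA.eigenvectorUnitary : Matrix n n ℂ) *
      diagonal (fun i => (f (hA.eigenvalues i) : ℂ)) * (hA.eigenvectorUnitary : Matrix n n ℂ)ᴴ := by
  rw [hA.cfc_eq]
  simp [IsHermitian.cfc, Unitary.conjStarAlgAut_apply, star_eq_conjTranspose, Function.comp_def]

theorem eq_mul_diagonal_mul {A : Matrix n n ℂ} (hA : A.IsHermitian) :
    A = (hA.eigenvectorUnitary : Matrix n n ℂ) *
      diagonal (fun i => (hA.eigenvalues i : ℂ)) * (hA.eigenvectorUnitary : Matrix n n ℂ)ᴴ := by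
  conv_lhs => rw [hA.spectral_theorem]
  simp [Unitary.conjStarAlgAut_apply, star_eq_conjTranspose, Function.comp_def]

theorem eigenvectorUnitary_conjTranspose_mul {A : Matrix n n ℂ} (hA : A.IsHermitian) :
    (hA.eigenvectorUnitary : Matrix n n ℂ)ᴴ * (hA.eigenvectorUnitary : Matrix n n ℂ) = 1 := by
  rw [← star_eq_conjTranspose]; exact Unitary.coe_star_mul_self _

/-- The trace of a product of functions of two Hermitian matrices, in terms of the eigenvalues. -/
theorem trace_cfc_mul_cfc {A B : Matrix n n ℂ} (hA : A.IsHermitian) (hB : B.IsHermitian)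
    (f g : ℝ → ℝ) :
    (cfc f A * cfc g B).trace.re = ∑ i, ∑ j, ‖eigenOverlap hA hB i j‖ ^ 2 *
      (f (hA.eigenvalues i) * g (hB.eigenvalues j)) := by
  have h : (cfc f A * cfc g B).trace =
      (diagonal (fun i => (f (hA.eigenvalues i) : ℂ)) * eigenOverlap hA hB *
        diagonal (fun i => (g (hB.eigenvalues i) : ℂ)) * (eigenOverlap hA hB)ᴴ).trace := by
    rw [cfc_eq_mul_diagonal_mul hA, cfc_eq_mul_diagonal_mul hB, eigenOverlap,
      conjTranspose_mul, conjTranspose_conjTranspose, mul_assoc, mul_assoc, trace_mul_comm]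
    simp only [mul_assoc]
  rw [h]
  simp only [trace, diag_apply, Matrix.mul_apply (N := (eigenOverlap hA hB)ᴴ), mul_diagonal,
    diagonal_mul, conjTranspose_apply, Complex.re_sum]
  refine Finset.sum_congr rfl fun i _ => Finset.sum_congr rfl fun j _ => ?_
  have : (f (hA.eigenvalues i) : ℂ) * eigenOverlap hA hB i j * (g (hB.eigenvalues j) : ℂ) *
      star (eigenOverlap hA hB i j) = ((‖eigenOverlap hA hB i j‖ ^ 2 *
      (f (hA.eigenvalues i) * g (hB.eigenvalues j)) : ℝ) : ℂ) := by
    rw [Complex.star_def]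
    calc _ = (f (hA.eigenvalues i) : ℂ) * (g (hB.eigenvalues j) : ℂ) *
          (eigenOverlap hA hB i j * (starRingEnd ℂ) (eigenOverlap hA hB i j)) := by ring
      _ = _ := by rw [Complex.mul_conj']; push_cast; ring
  rw [this, Complex.ofReal_re]

theorem cfc_id_eq {A : Matrix n n ℂ} (hA : A.IsHermitian) : cfc (fun x : ℝ => x) A = A :=
  cfc_id' ℝ A hA.isSelfAdjoint

theorem cfc_one_eq (A : Matrix n n ℂ) (hA : A.IsHermitian) :
    cfc (fun _ : ℝ => (1 : ℝ)) A = 1 :=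
  cfc_const_one ℝ A hA.isSelfAdjoint

variable {A B : Matrix n n ℂ}

/-- With all traces written as double sums over both eigenbases with the same nonnegative weights,
trace inequalities reduce to scalar inequalities between eigenvalues. -/
theorem trace_re_eq_left (hA : A.PosSemidef) (hB : B.PosSemidef) :
    A.trace.re = ∑ i, ∑ j, ‖eigenOverlap hA.1 hB.1 i j‖ ^ 2 * hA.1.eigenvalues i := by
  have := trace_cfc_mul_cfc hA.1 hB.1 (fun x => x) (fun _ => 1)
  rw [cfc_id_eq hA.1, cfc_one_eq B hB.1] at this
  simpa using this

theorem trace_re_eq_right (hA : A.PosSemidef) (hB : B.PosSemidef) :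
    B.trace.re = ∑ i, ∑ j, ‖eigenOverlap hA.1 hB.1 i j‖ ^ 2 * hB.1.eigenvalues j := by
  have := trace_cfc_mul_cfc hA.1 hB.1 (fun _ => 1) (fun x => x)
  rw [cfc_id_eq hB.1, cfc_one_eq A hA.1] at this
  simpa using this

theorem trace_cfc_eq_left (hA : A.PosSemidef) (hB : B.PosSemidef) (f : ℝ → ℝ) :
    (cfc f A).trace.re = ∑ i, ∑ j, ‖eigenOverlap hA.1 hB.1 i j‖ ^ 2 * f (hA.1.eigenvalues i) := by
  have := trace_cfc_mul_cfc hA.1 hB.1 f (fun _ => 1)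
  rw [cfc_one_eq B hB.1] at this
  simpa using this

theorem trace_mul_log_eq (hA : A.PosSemidef) (hB : B.PosSemidef) :
    (A * cfc Real.log B).trace.re = ∑ i, ∑ j, ‖eigenOverlap hA.1 hB.1 i j‖ ^ 2 *
      (hA.1.eigenvalues i * Real.log (hB.1.eigenvalues j)) := by
  have := trace_cfc_mul_cfc hA.1 hB.1 (fun x => x) Real.log
  rwa [cfc_id_eq hA.1] at this

theorem trace_mul_re_nonneg (hA : A.PosSemidef) (hB : B.PosSemidef) : 0 ≤ (A * B).trace.re := by
  have := trace_cfc_mul_cfc hA.1 hB.1 (fun x => x) (fun x => x)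
  rw [cfc_id_eq hA.1, cfc_id_eq hB.1] at this
  rw [this]
  exact Finset.sum_nonneg fun i _ => Finset.sum_nonneg fun j _ =>
    mul_nonneg (by positivity) (mul_nonneg (hA.eigenvalues_nonneg i) (hB.eigenvalues_nonneg j))

/-- Support condition: where `B` vanishes, so does `A ≤ B`. -/
theorem eigenOverlap_mul_eigenvalue_eq_zero (hA : A.PosSemidef) (hB : B.PosSemidef)
    (hAB : (B - A).PosSemidef) (i j : n)
    (hj : hB.1.eigenvalues j = 0) :
    ‖eigenOverlap hA.1 hB.1 i j‖ ^ 2 * hA.1.eigenvalues i = 0 := by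
  -- The test matrix is the projection onto the kernel of `B`. Its trace against `B - A` is
  -- nonnegative and its trace against `B` is zero, so its trace against `A`, a sum of nonnegative
  -- terms, vanishes.
  have h1 := trace_cfc_mul_cfc hA.1 hB.1 (fun x => x) (fun x => if x = 0 then 1 else 0)
  have h2 : (cfc (fun x : ℝ => if x = 0 then (1 : ℝ) else 0) B).PosSemidef := by
    rw [cfc_eq_mul_diagonal_mul hB.1]
    refine (PosSemidef.diagonal fun i => ?_).mul_mul_conjTranspose_same _
    split_ifs <;> simp
  have h3 := trace_mul_re_nonneg hAB h2
  have h4 : (B * cfc (fun x : ℝ => if x = 0 then (1 : ℝ) else 0) B).trace.re = 0 := by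
    have h5 : B * cfc (fun x : ℝ => if x = 0 then (1 : ℝ) else 0) B = 0 := by
      nth_rw 1 [← cfc_id_eq hB.1]
      rw [← cfc_mul (fun x : ℝ => x) (fun x : ℝ => if x = 0 then (1 : ℝ) else 0) B
        (Matrix.finite_real_spectrum.continuousOn _) (Matrix.finite_real_spectrum.continuousOn _)]
      have : (fun x : ℝ => x * (if x = 0 then (1 : ℝ) else 0)) = fun _ => 0 := by
        ext x; split_ifs with h <;> simp [h]
      rw [this]; exact cfc_const_zero ℝ B
    rw [h5]; simp
  rw [Matrix.sub_mul, trace_sub, Complex.sub_re, h4, zero_sub] at h3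
  rw [cfc_id_eq hA.1] at h1
  have h6 : ∀ i j, 0 ≤ ‖eigenOverlap hA.1 hB.1 i j‖ ^ 2 *
      (hA.1.eigenvalues i * (if hB.1.eigenvalues j = 0 then (1 : ℝ) else 0)) := fun i j =>
    mul_nonneg (by positivity) (mul_nonneg (hA.eigenvalues_nonneg i)
      (by split_ifs <;> norm_num))
  have h7 : ∑ i, ∑ j, ‖eigenOverlap hA.1 hB.1 i j‖ ^ 2 *
      (hA.1.eigenvalues i * (if hB.1.eigenvalues j = 0 then (1 : ℝ) else 0)) = 0 :=
    le_antisymm (by rw [← h1]; linarith)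
      (Finset.sum_nonneg fun i _ => Finset.sum_nonneg fun j _ => h6 i j)
  rw [Finset.sum_eq_zero_iff_of_nonneg (fun i _ => Finset.sum_nonneg fun j _ => h6 i j)] at h7
  have h8 := h7 i (Finset.mem_univ _)
  rw [Finset.sum_eq_zero_iff_of_nonneg (fun j _ => h6 i j)] at h8
  simpa [hj] using h8 j (Finset.mem_univ _)

theorem trace_cfc_negMulLog_eq (hA : A.PosSemidef) (hB : B.PosSemidef) :
    -(cfc Real.negMulLog A).trace.re = ∑ i, ∑ j, ‖eigenOverlap hA.1 hB.1 i j‖ ^ 2 *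
      (hA.1.eigenvalues i * Real.log (hA.1.eigenvalues i)) := by
  rw [trace_cfc_eq_left hA hB, ← Finset.sum_neg_distrib]
  refine Finset.sum_congr rfl fun i _ => ?_
  rw [← Finset.sum_neg_distrib]
  exact Finset.sum_congr rfl fun j _ => by simp [Real.negMulLog]

/-- Klein's inequality for `A ≤ B` and the scaled reference `ν B`. -/
theorem klein_inequality (hA : A.PosSemidef) (hB : B.PosSemidef)
    (hAB : (B - A).PosSemidef) {ν : ℝ} (hν : 0 < ν) :
    A.trace.re - ν * B.trace.re ≤ -(cfc Real.negMulLog A).trace.re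
      - (A * cfc Real.log B).trace.re - Real.log ν * A.trace.re := by
  rw [trace_cfc_negMulLog_eq hA hB, trace_mul_log_eq hA hB, trace_re_eq_left hA hB,
    trace_re_eq_right hA hB]
  simp only [Finset.mul_sum, ← Finset.sum_sub_distrib]
  refine Finset.sum_le_sum fun i _ => Finset.sum_le_sum fun j _ => ?_
  have hs := eigenOverlap_mul_eigenvalue_eq_zero hA hB hAB i j
  have ha := hA.eigenvalues_nonneg i
  have hb := hB.eigenvalues_nonneg j
  set w := ‖eigenOverlap hA.1 hB.1 i j‖ ^ 2
  have hw : 0 ≤ w := by positivity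
  set a := hA.1.eigenvalues i
  set b := hB.1.eigenvalues j
  suffices h : 0 ≤ w * (a * Real.log a - a * Real.log b - a * Real.log ν - a + ν * b) by
    nlinarith
  -- With the convention log 0 = 0 the scalar inequality can fail at b = 0; there the support
  -- condition makes the weighted term vanish.
  rcases eq_or_lt_of_le hb with hb0 | hb0
  · have h0 := hs hb0.symm
    rw [← hb0]
    have : w * (a * Real.log a - a * Real.log 0 - a * Real.log ν - a + ν * 0) =
      (w * a) * (Real.log a - Real.log 0 - Real.log ν - 1) := by ring
    rw [this, h0, zero_mul]
  · refine mul_nonneg hw ?_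
    rcases eq_or_lt_of_le ha with ha0 | ha0
    · rw [← ha0]; simp; positivity
    · have h1 := Real.add_one_le_exp (Real.log (ν * b / a))
      rw [Real.exp_log (by positivity), Real.log_div (by positivity) (by positivity),
        Real.log_mul (by positivity) (by positivity), le_div_iff₀ ha0] at h1
      nlinarith

/-- Variational form of the divergence with kernel `(x - y)² / (t y + (1 - t) x)`. -/
theorem exists_quadratic_divergence_eq (hA : A.PosSemidef) (hB : B.PosSemidef) (t : ℝ)
    (ht0 : 0 < t) (ht1 : t < 1) :
    ∃ Z : Matrix n n ℂ,
      ∑ i, ∑ j, ‖eigenOverlap hA.1 hB.1 i j‖ ^ 2 *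
        ((hA.1.eigenvalues i - hB.1.eigenvalues j) ^ 2 /
          (t * hB.1.eigenvalues j + (1 - t) * hA.1.eigenvalues i)) =
      2 * ((Z * A).trace.re - (Z * B).trace.re) - t * (Z * Zᴴ * B).trace.re
        - (1 - t) * (Zᴴ * Z * A).trace.re := by
  set X := eigenOverlap hA.1 hB.1 with hX
  set a := hA.1.eigenvalues with ha
  set b := hB.1.eigenvalues with hb
  set U := (hA.1.eigenvectorUnitary : Matrix n n ℂ) with hU
  set V := (hB.1.eigenvectorUnitary : Matrix n n ℂ) with hV
  have hUU : Uᴴ * U = 1 := eigenvectorUnitary_conjTranspose_mul hA.1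
  have hVV : Vᴴ * V = 1 := eigenvectorUnitary_conjTranspose_mul hB.1
  have hAe : A = U * diagonal (fun i => (a i : ℂ)) * Uᴴ := eq_mul_diagonal_mul hA.1
  have hBe : B = V * diagonal (fun i => (b i : ℂ)) * Vᴴ := eq_mul_diagonal_mul hB.1
  have hXe : X = Uᴴ * V := rfl
  -- The stationary point of 2c(a - b) - c²(tb + (1 - t)a). The witness has these coefficients,
  -- multiplied by the conjugate overlaps, between the two eigenbases.
  let c : n → n → ℝ := fun i j => (a i - b j) / (t * b j + (1 - t) * a i)
  let ζ : Matrix n n ℂ := Matrix.of fun j i => (c i j : ℂ) * star (X i j)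
  have hUc : ∀ C : Matrix n n ℂ, Uᴴ * (U * C) = C := fun C => by
    rw [← Matrix.mul_assoc, hUU, Matrix.one_mul]
  have hVc : ∀ C : Matrix n n ℂ, Vᴴ * (V * C) = C := fun C => by
    rw [← Matrix.mul_assoc, hVV, Matrix.one_mul]
  refine ⟨V * ζ * Uᴴ, ?_⟩
  have e1 : (V * ζ * Uᴴ * A).trace.re = ∑ i, ∑ j, ‖X i j‖ ^ 2 * (c i j * a i) := by
    have : (V * ζ * Uᴴ * A).trace = (diagonal (fun i => (a i : ℂ)) * X * ζ).trace := by
      rw [hAe, hXe]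
      simp only [Matrix.mul_assoc, hUc]
      rw [trace_mul_comm V, Matrix.mul_assoc, trace_mul_comm ζ]
      simp only [Matrix.mul_assoc]
    rw [this]
    simp only [trace, diag_apply, Matrix.mul_apply (N := ζ), diagonal_mul, Complex.re_sum]
    refine Finset.sum_congr rfl fun i _ => Finset.sum_congr rfl fun j _ => ?_
    simp only [ζ, of_apply]
    have : (a i : ℂ) * X i j * ((c i j : ℂ) * star (X i j)) =
        ((‖X i j‖ ^ 2 * (c i j * a i) : ℝ) : ℂ) := by
      rw [Complex.star_def]
      calc _ = (c i j : ℂ) * a i * (X i j * (starRingEnd ℂ) (X i j)) := by ring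
        _ = _ := by rw [Complex.mul_conj']; push_cast; ring
    rw [this, Complex.ofReal_re]
  have e2 : (V * ζ * Uᴴ * B).trace.re = ∑ i, ∑ j, ‖X i j‖ ^ 2 * (c i j * b j) := by
    have : (V * ζ * Uᴴ * B).trace = (X * diagonal (fun i => (b i : ℂ)) * ζ).trace := by
      rw [hBe, hXe]
      simp only [Matrix.mul_assoc]
      rw [trace_mul_comm V]
      simp only [Matrix.mul_assoc, hVV, Matrix.mul_one]
      rw [trace_mul_comm ζ]
      simp only [Matrix.mul_assoc]
    rw [this]
    simp only [trace, diag_apply, Matrix.mul_apply (N := ζ), mul_diagonal, Complex.re_sum]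
    refine Finset.sum_congr rfl fun i _ => Finset.sum_congr rfl fun j _ => ?_
    simp only [ζ, of_apply]
    have : X i j * (b j : ℂ) * ((c i j : ℂ) * star (X i j)) =
        ((‖X i j‖ ^ 2 * (c i j * b j) : ℝ) : ℂ) := by
      rw [Complex.star_def]
      calc _ = (c i j : ℂ) * b j * (X i j * (starRingEnd ℂ) (X i j)) := by ring
        _ = _ := by rw [Complex.mul_conj']; push_cast; ring
    rw [this, Complex.ofReal_re]
  have hζ : ∀ i j, ζ j i * star (ζ j i) = ((‖X i j‖ ^ 2 * c i j ^ 2 : ℝ) : ℂ) := fun i j => by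
    simp only [ζ, of_apply, star_mul', Complex.star_def, Complex.conj_ofReal, Complex.conj_conj]
    calc _ = (c i j : ℂ) ^ 2 * (X i j * (starRingEnd ℂ) (X i j)) := by ring
        _ = _ := by rw [Complex.mul_conj']; push_cast; ring
  have e3 : ((V * ζ * Uᴴ) * (V * ζ * Uᴴ)ᴴ * B).trace.re =
      ∑ i, ∑ j, ‖X i j‖ ^ 2 * (c i j ^ 2 * b j) := by
    have : ((V * ζ * Uᴴ) * (V * ζ * Uᴴ)ᴴ * B).trace =
        (diagonal (fun i => (b i : ℂ)) * ζ * ζᴴ).trace := by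
      rw [hBe]
      simp only [Matrix.mul_assoc, conjTranspose_mul, conjTranspose_conjTranspose, hUc, hVc]
      rw [trace_mul_comm V]
      simp only [Matrix.mul_assoc, hVV, Matrix.mul_one]
      rw [← Matrix.mul_assoc ζ, trace_mul_comm (ζ * ζᴴ)]
    rw [this, Finset.sum_comm]
    simp only [trace, diag_apply, Matrix.mul_apply (N := ζᴴ), diagonal_mul, Complex.re_sum,
      conjTranspose_apply, mul_assoc, hζ, Finset.mul_sum]
    refine Finset.sum_congr rfl fun i _ => Finset.sum_congr rfl fun j _ => ?_
    rw [← Complex.ofReal_mul, Complex.ofReal_re]; ring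
  have e4 : ((V * ζ * Uᴴ)ᴴ * (V * ζ * Uᴴ) * A).trace.re =
      ∑ i, ∑ j, ‖X i j‖ ^ 2 * (c i j ^ 2 * a i) := by
    have : ((V * ζ * Uᴴ)ᴴ * (V * ζ * Uᴴ) * A).trace =
        (diagonal (fun i => (a i : ℂ)) * ζᴴ * ζ).trace := by
      rw [hAe]
      simp only [Matrix.mul_assoc, conjTranspose_mul, conjTranspose_conjTranspose, hUc, hVc]
      rw [trace_mul_comm U]
      simp only [Matrix.mul_assoc, hUU, Matrix.mul_one]
      rw [← Matrix.mul_assoc ζᴴ, trace_mul_comm (ζᴴ * ζ)]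
    rw [this]
    simp only [trace, diag_apply, Matrix.mul_apply (N := ζ), diagonal_mul, Complex.re_sum,
      conjTranspose_apply, mul_assoc, Finset.mul_sum]
    refine Finset.sum_congr rfl fun i _ => Finset.sum_congr rfl fun j _ => ?_
    rw [mul_comm (star _), hζ, ← Complex.ofReal_mul, Complex.ofReal_re]; ring
  rw [e1, e2, e3, e4]
  simp only [Finset.mul_sum, ← Finset.sum_sub_distrib]
  refine Finset.sum_congr rfl fun i _ => Finset.sum_congr rfl fun j _ => ?_
  have ha0 : 0 ≤ a i := hA.eigenvalues_nonneg i
  have hb0 : 0 ≤ b j := hB.eigenvalues_nonneg j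
  -- A zero denominator makes both the quotient and `c i j` zero by the convention x / 0 = 0.
  rcases eq_or_ne (t * b j + (1 - t) * a i) 0 with hD | hD
  · have h1 : 0 ≤ t * b j := by positivity
    have h2 : 0 ≤ (1 - t) * a i := mul_nonneg (by linarith) ha0
    simp [c, hD]
  · have hc : c i j * (t * b j + (1 - t) * a i) = a i - b j := div_mul_cancel₀ _ hD
    have : (a i - b j) ^ 2 / (t * b j + (1 - t) * a i) = c i j * (a i - b j) := by
      simp only [c]; ring
    rw [this]; linear_combination ‖X i j‖ ^ 2 * c i j * hc

end Spectral

/-! ### Entrywise integrals of positive semidefinite matrices -/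

section MatrixIntegral

variable {n Z : Type*} [Fintype n] [MeasurableSpace Z]

theorem _root_.Matrix.PosSemidef.trace_re_nonneg {A : Matrix n n ℂ} (hA : A.PosSemidef) :
    0 ≤ A.trace.re :=
  (Complex.nonneg_iff.1 hA.trace_nonneg).1

omit [Fintype n] in
theorem _root_.Matrix.PosSemidef.diag_re_nonneg {A : Matrix n n ℂ} (hA : A.PosSemidef) (i : n) :
    0 ≤ (A i i).re :=
  (Complex.nonneg_iff.1 (hA.diag_nonneg (i := i))).1

theorem _root_.Matrix.PosSemidef.diag_re_le_trace {A : Matrix n n ℂ} (hA : A.PosSemidef) (i : n) :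
    (A i i).re ≤ A.trace.re := by
  rw [trace, Complex.re_sum]
  exact Finset.single_le_sum (f := fun i => (A i i).re) (fun j _ => hA.diag_re_nonneg j)
    (Finset.mem_univ i)

/-- The principal minor on `i`, `j` is nonnegative, so the squared modulus of the entry is at most
the product of two diagonal entries. Integrability of the trace therefore gives integrability of
every entry. -/
theorem _root_.Matrix.PosSemidef.norm_apply_le_trace {A : Matrix n n ℂ} (hA : A.PosSemidef)
    (i j : n) : ‖A i j‖ ≤ A.trace.re := by
  have h := (Complex.nonneg_iff.1 (hA.submatrix ![i, j]).det_nonneg).1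
  rw [det_fin_two] at h
  simp only [submatrix_apply, cons_val_zero, cons_val_one] at h
  have h1 : A j i = (starRingEnd ℂ) (A i j) := by
    rw [← Complex.star_def, ← conjTranspose_apply, hA.1]
  have h2 : ((A j j).im) = 0 := (Complex.nonneg_iff.1 (hA.diag_nonneg (i := j))).2.symm
  rw [h1, Complex.mul_conj', Complex.sub_re, Complex.mul_re, h2, mul_zero, sub_zero] at h
  have h3 : ((‖A i j‖ : ℂ) ^ 2).re = ‖A i j‖ ^ 2 := by
    rw [← Complex.ofReal_pow, Complex.ofReal_re]
  rw [h3] at h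
  have := mul_le_mul (hA.diag_re_le_trace i) (hA.diag_re_le_trace j) (hA.diag_re_nonneg j)
    hA.trace_re_nonneg
  exact le_of_sq_le_sq (by nlinarith) hA.trace_re_nonneg

/-- Entrywise integral of a matrix-valued function. -/
noncomputable def matrixIntegral (μ : Measure Z) (Φ : Z → Matrix n n ℂ) : Matrix n n ℂ :=
  Matrix.of fun i j => ∫ z, Φ z i j ∂μ

variable {μ : Measure Z} {Φ : Z → Matrix n n ℂ}

theorem trace_mul_matrixIntegral (hΦ : ∀ i j, Integrable (fun z => Φ z i j) μ)
    (C : Matrix n n ℂ) : (C * matrixIntegral μ Φ).trace = ∫ z, (C * Φ z).trace ∂μ := by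
  simp only [trace, diag_apply, Matrix.mul_apply, matrixIntegral, of_apply]
  refine Eq.symm <| (integral_finsetSum _ fun i _ => integrable_finsetSum _ fun j _ =>
    (hΦ j i).const_mul _).trans <| Finset.sum_congr rfl fun i _ => ?_
  rw [integral_finsetSum _ fun j _ => (hΦ j i).const_mul _]
  exact Finset.sum_congr rfl fun j _ => integral_const_mul _ _

theorem integrable_trace_mul (hΦ : ∀ i j, Integrable (fun z => Φ z i j) μ) (C : Matrix n n ℂ) :
    Integrable (fun z => (C * Φ z).trace) μ := by
  simp only [trace, diag_apply, Matrix.mul_apply]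
  exact integrable_finsetSum _ fun i _ => integrable_finsetSum _ fun j _ => (hΦ j i).const_mul _

theorem trace_mul_matrixIntegral_re (hΦ : ∀ i j, Integrable (fun z => Φ z i j) μ)
    (C : Matrix n n ℂ) :
    (C * matrixIntegral μ Φ).trace.re = ∫ z, (C * Φ z).trace.re ∂μ := by
  rw [trace_mul_matrixIntegral hΦ]
  exact (Complex.reCLM.integral_comp_comm (integrable_trace_mul hΦ C)).symm

theorem posSemidef_matrixIntegral (hΦ : ∀ i j, Integrable (fun z => Φ z i j) μ)
    (hpos : ∀ z, (Φ z).PosSemidef) : (matrixIntegral μ Φ).PosSemidef := by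
  refine PosSemidef.of_dotProduct_mulVec_nonneg ?_ fun x => ?_
  · ext i j
    rw [conjTranspose_apply, matrixIntegral, of_apply, of_apply, Complex.star_def, ← integral_conj]
    refine integral_congr_ae (.of_forall fun z => ?_)
    dsimp only
    rw [← Complex.star_def, ← conjTranspose_apply, (hpos z).1]
  -- A quadratic form is a trace against a rank-one matrix, and such traces commute with the
  -- integral.
  · have h : ∀ M : Matrix n n ℂ, star x ⬝ᵥ (M *ᵥ x) = (vecMulVec x (star x) * M).trace := by
      intro M
      rw [vecMulVec_eq Unit, Matrix.mul_assoc, trace_mul_comm]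
      simp [trace, Matrix.mul_apply, dotProduct, mulVec, Finset.mul_sum, Finset.sum_mul]
      rw [Finset.sum_comm]
      exact Finset.sum_congr rfl fun i _ => Finset.sum_congr rfl fun j _ => by ring
    rw [h, trace_mul_matrixIntegral hΦ]
    refine integral_nonneg fun z => ?_
    dsimp only
    rw [Pi.zero_apply, ← h]
    exact (hpos z).dotProduct_mulVec_nonneg x

end MatrixIntegral

/-! ### Scalar integral representation of relative entropy -/

section Kernel

/-- The kernel in the integral representation of the relative entropy. -/
noncomputable def divergenceKernel (t a b : ℝ) : ℝ :=
  t * ((a - b) ^ 2 / (t * b + (1 - t) * a))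

theorem divergenceKernel_nonneg {t a b : ℝ} (ht0 : 0 ≤ t) (ht1 : t ≤ 1) (ha : 0 ≤ a)
    (hb : 0 ≤ b) : 0 ≤ divergenceKernel t a b := by
  have : 0 ≤ 1 - t := by linarith
  unfold divergenceKernel; positivity

/-- A bound uniform in t: it makes tr Φ a dominating function when the integrals over t and z are
exchanged. -/
theorem divergenceKernel_one_le {t k : ℝ} (ht0 : 0 ≤ t) (ht1 : t ≤ 1) (hk0 : 0 ≤ k)
    (hk1 : k ≤ 1) : divergenceKernel t k 1 ≤ 1 := by
  unfold divergenceKernel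
  have h1 : 0 ≤ (1 - t) * k := mul_nonneg (by linarith) hk0
  rw [mul_one, ← mul_div_assoc]
  refine div_le_one_of_le₀ ?_ (by linarith)
  nlinarith [mul_nonneg ht0 hk0, mul_nonneg (mul_nonneg ht0 hk0) (sub_nonneg.2 hk1)]

theorem hasIntegral_divergenceKernel {a b : ℝ} (ha : 0 ≤ a) (hb : 0 < b) :
    IntervalIntegrable (fun t => divergenceKernel t a b) volume 0 1 ∧
    ∫ t in (0 : ℝ)..1, divergenceKernel t a b = a * Real.log a - a * Real.log b - a + b := by
  rcases eq_or_lt_of_le ha with rfl | ha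
  -- For a = 0 the kernel is the constant b except at t = 0, where the quotient is 0/0; the open
  -- interval avoids that endpoint.
  · have h : Set.EqOn (fun t => divergenceKernel t 0 b) (fun _ => b) (Set.uIoo 0 1) := by
      intro t ht
      rw [Set.uIoo_of_le zero_le_one] at ht
      have := ht.1.ne'
      simp only [divergenceKernel]
      field_simp
      ring
    constructor
    · exact (intervalIntegrable_const (c := b)).congr_uIoo h.symm
    · rw [intervalIntegral.integral_congr_uIoo h]; simp
  · have hD : ∀ t ∈ Set.uIcc (0 : ℝ) 1, 0 < t * b + (1 - t) * a := by
      intro t ht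
      rw [Set.uIcc_of_le zero_le_one] at ht
      rcases eq_or_lt_of_le ht.1 with h0 | h0
      · rw [← h0]; simpa using ha
      · have : 0 ≤ (1 - t) * a := mul_nonneg (by linarith [ht.2]) ha.le
        positivity
    have hint : IntervalIntegrable (fun t => divergenceKernel t a b) volume 0 1 := by
      refine ContinuousOn.intervalIntegrable ?_
      unfold divergenceKernel
      refine continuousOn_id.mul (continuousOn_const.div (by fun_prop) fun t ht => (hD t ht).ne')
    refine ⟨hint, ?_⟩
    rw [intervalIntegral.integral_eq_sub_of_hasDerivAt
      (f := fun t => (b - a) * t - a * Real.log (t * b + (1 - t) * a)) ?_ hint]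
    · simp; ring
    · intro t ht
      have hd := hD t ht
      have h1 : HasDerivAt (fun t : ℝ => t * b + (1 - t) * a) (b - a) t := by
        have := ((hasDerivAt_id t).mul_const b).add
          (((hasDerivAt_id t).const_sub 1).mul_const a)
        exact this.congr_deriv (by ring)
      have h2 := ((hasDerivAt_id t).const_mul (b - a)).sub ((h1.log hd.ne').const_mul a)
      refine h2.congr_deriv ?_
      unfold divergenceKernel
      obtain ⟨D, hDe⟩ : ∃ D, D = t * b + (1 - t) * a := ⟨_, rfl⟩
      rw [← hDe] at hd ⊢
      field_simp
      rw [hDe]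
      ring

end Kernel

/-! ### Data processing from a classical register to a quantum state -/

section Divergence

variable {n Z : Type*} [Fintype n] [DecidableEq n] [MeasurableSpace Z]

/-- Expansion of tr (C - c)Φ(C - c)ᴴ ≥ 0. -/
theorem trace_conj_mul_ge {Φ : Matrix n n ℂ} (hΦ : Φ.PosSemidef) (C : Matrix n n ℂ) (c : ℝ) :
    2 * c * (C * Φ).trace.re - c ^ 2 * Φ.trace.re ≤ (Cᴴ * C * Φ).trace.re := by
  have h := (hΦ.mul_mul_conjTranspose_same (C - (c : ℂ) • (1 : Matrix n n ℂ))).trace_re_nonneg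
  have h1 : (Φ * Cᴴ).trace.re = (C * Φ).trace.re := by
    rw [← Complex.conj_re, ← Complex.star_def, ← trace_conjTranspose, conjTranspose_mul,
      conjTranspose_conjTranspose, hΦ.1]
  have h2 : (C * Φ * Cᴴ).trace = (Cᴴ * C * Φ).trace := by
    rw [trace_mul_comm, Matrix.mul_assoc]
  simp only [conjTranspose_sub, conjTranspose_smul, conjTranspose_one, Complex.star_def,
    Complex.conj_ofReal, Matrix.sub_mul, Matrix.mul_sub, Matrix.smul_mul, Matrix.mul_smul,
    Matrix.one_mul, Matrix.mul_one, trace_sub, trace_smul, smul_eq_mul, Complex.sub_re,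
    Complex.re_ofReal_mul, h1, h2] at h
  nlinarith

/-- The variational expression at the proportional pair kΦ, Φ. The two squares are completed around
the same scalar c, the commuting analogue of the optimal witness, so no choice of `C` exceeds the
classical value. -/
theorem quadratic_le_divergenceKernel {Φ : Matrix n n ℂ} (hΦ : Φ.PosSemidef) (C : Matrix n n ℂ)
    {t k : ℝ} (ht0 : 0 < t) (ht1 : t < 1) (hk : 0 ≤ k) :
    2 * (k * (C * Φ).trace.re - (C * Φ).trace.re) - t * (C * Cᴴ * Φ).trace.re
        - (1 - t) * (k * (Cᴴ * C * Φ).trace.re) ≤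
      (k - 1) ^ 2 / (t * 1 + (1 - t) * k) * Φ.trace.re := by
  have hD : 0 < t * 1 + (1 - t) * k := by
    have : 0 ≤ (1 - t) * k := mul_nonneg (by linarith) hk
    linarith
  obtain ⟨c, hc⟩ : ∃ c, c = (k - 1) / (t * 1 + (1 - t) * k) := ⟨_, rfl⟩
  have hcD : c * (t * 1 + (1 - t) * k) = k - 1 := by rw [hc]; exact div_mul_cancel₀ _ hD.ne'
  have h1 := trace_conj_mul_ge hΦ C c
  have h2 := trace_conj_mul_ge hΦ Cᴴ c
  have h3 : (Cᴴ * Φ).trace.re = (C * Φ).trace.re := by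
    rw [← Complex.conj_re, ← Complex.star_def, ← trace_conjTranspose, conjTranspose_mul,
      conjTranspose_conjTranspose, hΦ.1, trace_mul_comm]
  rw [conjTranspose_conjTranspose, h3] at h2
  have e : (k - 1) ^ 2 / (t * 1 + (1 - t) * k) = c * (k - 1) := by rw [hc]; ring
  rw [e]
  have h4 := mul_le_mul_of_nonneg_left h2 ht0.le
  have h5 := mul_le_mul_of_nonneg_left h1 (mul_nonneg (sub_nonneg.2 ht1.le) hk)
  have e1 : t * (2 * c * (C * Φ).trace.re - c ^ 2 * Φ.trace.re) +
      (1 - t) * k * (2 * c * (C * Φ).trace.re - c ^ 2 * Φ.trace.re) =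
      2 * (k - 1) * (C * Φ).trace.re - c * (k - 1) * Φ.trace.re := by
    rw [← hcD]; ring
  nlinarith

variable {μ : Measure Z} {Φ : Z → Matrix n n ℂ}

omit [DecidableEq n] in
theorem integrable_apply_of_trace (hm : ∀ i j, Measurable fun z => Φ z i j)
    (hpos : ∀ z, (Φ z).PosSemidef) (hi : Integrable (fun z => (Φ z).trace.re) μ) (i j : n) :
    Integrable (fun z => Φ z i j) μ :=
  hi.mono' (hm i j).aestronglyMeasurable (.of_forall fun z => (hpos z).norm_apply_le_trace i j)

theorem integrable_weight_mul {μ : Measure Z} {f h : Z → ℝ} (hh : Measurable h)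
    (h0 : ∀ z, 0 ≤ h z) (h1 : ∀ z, h z ≤ 1) (hf : Integrable f μ) :
    Integrable (fun z => h z * f z) μ :=
  hf.bdd_mul (c := 1) hh.aestronglyMeasurable (.of_forall fun z => by
    rw [Real.norm_of_nonneg (h0 z)]; exact h1 z)

theorem integrable_smul_of_bounded {k : Z → ℝ} (hk : Measurable k) (hk0 : ∀ z, 0 ≤ k z)
    (hk1 : ∀ z, k z ≤ 1) {f : Z → ℂ} (hf : Integrable f μ) :
    Integrable (fun z => (k z : ℂ) * f z) μ :=
  hf.bdd_mul (c := 1) (by fun_prop) (.of_forall fun z => by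
    rw [Complex.norm_real, Real.norm_of_nonneg (hk0 z)]; exact hk1 z)

/-- Data processing for the preparation of a quantum state from a classical register: relative
entropy of `∫ k Φ` and `∫ Φ` for a positive operator valued density `Φ` and weights `k`. -/
theorem relEntropy_matrixIntegral_le [SFinite μ] (hm : ∀ i j, Measurable fun z => Φ z i j)
    (hpos : ∀ z, (Φ z).PosSemidef) (hi : Integrable (fun z => (Φ z).trace.re) μ)
    {k : Z → ℝ} (hk : Measurable k) (hk0 : ∀ z, 0 ≤ k z) (hk1 : ∀ z, k z ≤ 1) :
    -(cfc Real.negMulLog (matrixIntegral μ fun z => (k z : ℂ) • Φ z)).trace.re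
        - ((matrixIntegral μ fun z => (k z : ℂ) • Φ z) *
          cfc Real.log (matrixIntegral μ Φ)).trace.re ≤
      ∫ z, k z * Real.log (k z) * (Φ z).trace.re ∂μ := by
  have hΦi := integrable_apply_of_trace hm hpos hi
  have hkΦi : ∀ i j, Integrable (fun z => ((k z : ℂ) • Φ z) i j) μ := fun i j =>
    integrable_smul_of_bounded hk hk0 hk1 (hΦi i j)
  set A := matrixIntegral μ fun z => (k z : ℂ) • Φ z with hAdef
  set B := matrixIntegral μ Φ with hBdef
  have hA : A.PosSemidef := posSemidef_matrixIntegral hkΦi fun z =>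
    (hpos z).smul (by exact_mod_cast hk0 z)
  have hB : B.PosSemidef := posSemidef_matrixIntegral hΦi hpos
  -- B - A = ∫ (1 - k)Φ, so k ≤ 1 supplies the support condition.
  have hAB : (B - A).PosSemidef := by
    have h : B - A = matrixIntegral μ fun z => ((1 - k z : ℝ) : ℂ) • Φ z := by
      ext i j
      simp only [hAdef, hBdef, matrixIntegral, Matrix.sub_apply, of_apply]
      rw [← integral_sub (hΦi i j) (hkΦi i j)]
      refine integral_congr_ae (.of_forall fun z => ?_)
      simp [sub_mul]
    rw [h]
    refine posSemidef_matrixIntegral (fun i j => integrable_smul_of_bounded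
      (k := fun z => 1 - k z) (measurable_const.sub hk) (fun z => sub_nonneg.2 (hk1 z))
      (fun z => by linarith [hk0 z]) (hΦi i j)) fun z => (hpos z).smul ?_
    exact_mod_cast sub_nonneg.2 (hk1 z)
  set W : n → n → ℝ := fun i j => ‖eigenOverlap hA.1 hB.1 i j‖ ^ 2 with hW
  set a := hA.1.eigenvalues with ha
  set b := hB.1.eigenvalues with hb
  have ha0 : ∀ i, 0 ≤ a i := hA.eigenvalues_nonneg
  have hb0 : ∀ j, 0 ≤ b j := hB.eigenvalues_nonneg
  have hterm : ∀ i j, IntervalIntegrable (fun t => W i j * divergenceKernel t (a i) (b j))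
      volume 0 1 ∧ ∫ t in (0 : ℝ)..1, W i j * divergenceKernel t (a i) (b j) =
        W i j * (a i * Real.log (a i) - a i * Real.log (b j) - a i + b j) := by
    intro i j
    -- The integral formula needs b > 0; for b = 0 the support condition annihilates both sides.
    rcases eq_or_lt_of_le (hb0 j) with h0 | h0
    · have h1 : W i j * a i = 0 := eigenOverlap_mul_eigenvalue_eq_zero hA hB hAB i j h0.symm
      have h2 : (fun t => W i j * divergenceKernel t (a i) (b j)) = fun _ => 0 := by
        ext t
        have : W i j * divergenceKernel t (a i) (b j) =
            (W i j * a i) * (t * (a i / (t * 0 + (1 - t) * a i))) := by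
          rw [← h0, divergenceKernel, sub_zero]; ring
        rw [this, h1, zero_mul]
      rw [h2]
      refine ⟨intervalIntegrable_const, ?_⟩
      have : W i j * (a i * Real.log (a i) - a i * Real.log (b j) - a i + b j) =
          (W i j * a i) * (Real.log (a i) - Real.log (b j) - 1) := by rw [← h0]; ring
      rw [this, h1]; simp
    · obtain ⟨h1, h2⟩ := hasIntegral_divergenceKernel (ha0 i) h0
      exact ⟨h1.const_mul _, by rw [intervalIntegral.integral_const_mul, h2]⟩
  have hsum : -(cfc Real.negMulLog A).trace.re - (A * cfc Real.log B).trace.re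
      - A.trace.re + B.trace.re =
      ∫ t in (0 : ℝ)..1, ∑ i, ∑ j, W i j * divergenceKernel t (a i) (b j) := by
    rw [trace_cfc_negMulLog_eq hA hB, trace_mul_log_eq hA hB, trace_re_eq_left hA hB,
      trace_re_eq_right hA hB, intervalIntegral.integral_finsetSum fun i _ => ?_]
    · simp only [← Finset.sum_sub_distrib, ← Finset.sum_add_distrib]
      refine Finset.sum_congr rfl fun i _ => ?_
      rw [intervalIntegral.integral_finsetSum fun j _ => (hterm i j).1]
      refine Finset.sum_congr rfl fun j _ => ?_
      rw [(hterm i j).2]; ring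
    · have := IntervalIntegrable.sum Finset.univ fun j _ => (hterm i j).1
      simpa [Finset.sum_fn] using this
  have hsumi : IntervalIntegrable (fun t => ∑ i, ∑ j, W i j * divergenceKernel t (a i) (b j))
      volume 0 1 := by
    have := IntervalIntegrable.sum Finset.univ fun i _ =>
      IntervalIntegrable.sum Finset.univ fun j _ => (hterm i j).1
    simpa [Finset.sum_fn] using this
  have hAtr : ∀ C : Matrix n n ℂ, (C * A).trace.re = ∫ z, k z * (C * Φ z).trace.re ∂μ := by
    intro C
    rw [trace_mul_matrixIntegral_re hkΦi]
    refine integral_congr_ae (.of_forall fun z => ?_)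
    simp
  have hBtr : ∀ C : Matrix n n ℂ, (C * B).trace.re = ∫ z, (C * Φ z).trace.re ∂μ :=
    fun C => trace_mul_matrixIntegral_re hΦi C
  have hBi : ∀ C : Matrix n n ℂ, Integrable (fun z => (C * Φ z).trace.re) μ := fun C =>
    (integrable_trace_mul hΦi C).re
  have hAi : ∀ C : Matrix n n ℂ, Integrable (fun z => k z * (C * Φ z).trace.re) μ := fun C =>
    integrable_weight_mul hk hk0 hk1 (hBi C)
  have hkm : Measurable fun p : ℝ × Z => divergenceKernel p.1 (k p.2) 1 := by
    unfold divergenceKernel; fun_prop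
  have hpt : ∀ t ∈ Set.Ioo (0 : ℝ) 1, ∑ i, ∑ j, W i j * divergenceKernel t (a i) (b j) ≤
      ∫ z, divergenceKernel t (k z) 1 * (Φ z).trace.re ∂μ := by
    intro t ht
    -- The witness depends on t but not on z, so for fixed t the expression is linear in A and B and
    -- becomes an integral over z.
    obtain ⟨C, hC⟩ := exists_quadratic_divergence_eq hA hB t ht.1 ht.2
    have i1 : Integrable (fun z => 2 * (k z * (C * Φ z).trace.re - (C * Φ z).trace.re)) μ :=
      ((hAi C).sub (hBi C)).const_mul 2
    have i2 : Integrable (fun z => t * (C * Cᴴ * Φ z).trace.re) μ := (hBi _).const_mul t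
    have i3 : Integrable (fun z => (1 - t) * (k z * (Cᴴ * C * Φ z).trace.re)) μ :=
      (hAi _).const_mul _
    have i4 : Integrable (fun z => 2 * (k z * (C * Φ z).trace.re - (C * Φ z).trace.re) -
      t * (C * Cᴴ * Φ z).trace.re) μ := i1.sub i2
    rw [hAtr, hBtr, hBtr, hAtr, ← integral_sub (hAi _) (hBi _), ← integral_const_mul,
      ← integral_const_mul, ← integral_const_mul, ← integral_sub i1 i2, ← integral_sub i4 i3] at hC
    have h1 : ∑ i, ∑ j, W i j * divergenceKernel t (a i) (b j) = t * ∑ i, ∑ j, W i j *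
        ((a i - b j) ^ 2 / (t * b j + (1 - t) * a i)) := by
      simp only [Finset.mul_sum, divergenceKernel]
      exact Finset.sum_congr rfl fun i _ => Finset.sum_congr rfl fun j _ => by ring
    rw [h1, hC, ← integral_const_mul]
    refine integral_mono ((i4.sub i3).const_mul _)
      (integrable_weight_mul (hkm.comp measurable_prodMk_left)
        (fun z => divergenceKernel_nonneg ht.1.le ht.2.le (hk0 z) zero_le_one)
        (fun z => divergenceKernel_one_le ht.1.le ht.2.le (hk0 z) (hk1 z)) hi) fun z => ?_
    have := quadratic_le_divergenceKernel (hpos z) C ht.1 ht.2 (hk0 z)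
    have := mul_le_mul_of_nonneg_left this ht.1.le
    simp only [divergenceKernel]
    rw [mul_assoc t]
    exact this
  have hprod : Integrable (Function.uncurry fun t z => divergenceKernel t (k z) 1 *
      (Φ z).trace.re) ((volume.restrict (Set.Ioc (0 : ℝ) 1)).prod μ) := by
    refine (hi.comp_snd (volume.restrict (Set.Ioc (0 : ℝ) 1))).mono' ?_ ?_
    · refine (hkm.mul ?_).aestronglyMeasurable
      have : Measurable fun z => (Φ z).trace.re := by
        simp only [trace, diag_apply, Complex.re_sum]
        exact Finset.measurable_sum _ fun i _ => Complex.measurable_re.comp (hm i i)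
      exact this.comp measurable_snd
    · have : ∀ᵐ p ∂((volume.restrict (Set.Ioc (0 : ℝ) 1)).prod μ), p.1 ∈ Set.Ioc (0 : ℝ) 1 :=
        Measure.quasiMeasurePreserving_fst.ae (ae_restrict_mem measurableSet_Ioc)
      filter_upwards [this] with p hp
      have h0 := (hpos p.2).trace_re_nonneg
      have h1 := divergenceKernel_nonneg hp.1.le hp.2 (hk0 p.2) zero_le_one
      rw [Function.uncurry_apply_pair, Real.norm_of_nonneg (mul_nonneg h1 h0)]
      exact mul_le_of_le_one_left h0 (divergenceKernel_one_le hp.1.le hp.2 (hk0 _) (hk1 _))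
  have hswap : ∫ t in (0 : ℝ)..1, ∫ z, divergenceKernel t (k z) 1 * (Φ z).trace.re ∂μ =
      ∫ z, (k z * Real.log (k z) - k z + 1) * (Φ z).trace.re ∂μ := by
    rw [intervalIntegral.integral_of_le zero_le_one, integral_integral_swap hprod]
    refine integral_congr_ae (.of_forall fun z => ?_)
    dsimp only
    rw [integral_mul_const, ← intervalIntegral.integral_of_le zero_le_one,
      (hasIntegral_divergenceKernel (hk0 z) one_pos).2]
    simp
  have hle : ∫ t in (0 : ℝ)..1, ∑ i, ∑ j, W i j * divergenceKernel t (a i) (b j) ≤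
      ∫ t in (0 : ℝ)..1, ∫ z, divergenceKernel t (k z) 1 * (Φ z).trace.re ∂μ :=
    intervalIntegral.integral_mono_on_of_le_Ioo zero_le_one hsumi
      ((intervalIntegrable_iff_integrableOn_Ioc_of_le zero_le_one).2 hprod.integral_prod_left) hpt
  -- The weight -k log k lies in [0, 1], since it is at most 1 - k.
  have hlog : Integrable (fun z => k z * Real.log (k z) * (Φ z).trace.re) μ := by
    have h1 : Integrable (fun z => Real.negMulLog (k z) * (Φ z).trace.re) μ :=
      integrable_weight_mul (Real.continuous_negMulLog.measurable.comp hk)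
        (fun z => Real.negMulLog_nonneg (hk0 z) (hk1 z))
        (fun z => (Real.negMulLog_le_one_sub_self (hk0 z)).trans (by linarith [hk0 z])) hi
    refine h1.neg.congr (.of_forall fun z => ?_)
    simp [Real.negMulLog]
  have hA1 := hAtr 1
  have hB1 := hBtr 1
  simp only [Matrix.one_mul] at hA1 hB1
  have hki : Integrable (fun z => k z * (Φ z).trace.re) μ := integrable_weight_mul hk hk0 hk1 hi
  have hfin : ∫ z, (k z * Real.log (k z) - k z + 1) * (Φ z).trace.re ∂μ =
      ∫ z, k z * Real.log (k z) * (Φ z).trace.re ∂μ - A.trace.re + B.trace.re := by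
    have hsub : Integrable (fun z => k z * Real.log (k z) * (Φ z).trace.re -
      k z * (Φ z).trace.re) μ := hlog.sub hki
    rw [hA1, hB1, ← integral_sub hlog hki, ← integral_add hsub hi]
    exact integral_congr_ae (.of_forall fun z => by dsimp only; ring)
  linarith

end Divergence

/-! ### The divergence bound on conditional mutual information -/

section CondMutualInfo

variable {n : Type*} [Fintype n] [DecidableEq n]

theorem trace_mul_log_self {A : Matrix n n ℂ} (hA : A.IsHermitian) :
    (A * cfc Real.log A).trace.re = -(cfc Real.negMulLog A).trace.re := by
  have h : A * cfc Real.log A = -cfc Real.negMulLog A := by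
    have h1 := cfc_mul (fun x : ℝ => x) Real.log A
      (Matrix.finite_real_spectrum.continuousOn _) (Matrix.finite_real_spectrum.continuousOn _)
    rw [cfc_id_eq hA] at h1
    rw [← h1, ← cfc_neg]
    congr 1
    ext x
    simp [Real.negMulLog]
  rw [h, trace_neg, Complex.neg_re]

omit [Fintype n] [DecidableEq n] in
theorem posSemidef_sum_sub {Y : Type*} [Fintype Y] {ω : Y → Matrix n n ℂ}
    (hω : ∀ y, (ω y).PosSemidef) (y : Y) : ((∑ y, ω y) - ω y).PosSemidef := by
  classical
  rw [← Finset.add_sum_erase _ _ (Finset.mem_univ y), add_sub_cancel_left]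
  exact posSemidef_sum _ fun z _ => hω z

/-- `S(Y | Q)` is at most the cross entropy of the law of `Y` with respect to `ν`. -/
theorem sum_trace_negMulLog_sub_le {Y : Type*} [Fintype Y] {ω : Y → Matrix n n ℂ}
    (hω : ∀ y, (ω y).PosSemidef) {ν : Y → ℝ} (hν : ∀ y, 0 ≤ ν y) (hν1 : ∑ y, ν y ≤ 1)
    (h0 : ∀ y, ν y = 0 → ω y = 0) :
    ∑ y, (cfc Real.negMulLog (ω y)).trace.re - (cfc Real.negMulLog (∑ y, ω y)).trace.re ≤
      -∑ y, Real.log (ν y) * (ω y).trace.re := by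
  have hB : (∑ y, ω y).PosSemidef := posSemidef_sum _ fun y _ => hω y
  have h1 : ∀ y, (ω y).trace.re - ν y * (∑ y, ω y).trace.re ≤
      -(cfc Real.negMulLog (ω y)).trace.re - (ω y * cfc Real.log (∑ y, ω y)).trace.re
        - Real.log (ν y) * (ω y).trace.re := by
    intro y
    rcases eq_or_lt_of_le (hν y) with h | h
    · rw [← h, h0 y h.symm]
      simp [cfc_apply_zero]
    · exact klein_inequality (hω y) hB (posSemidef_sum_sub hω y) h
  have h2 := Finset.sum_le_sum fun y (_ : y ∈ Finset.univ) => h1 y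
  simp only [Finset.sum_sub_distrib, Finset.sum_neg_distrib] at h2
  have h3 : ∑ y, (ω y * cfc Real.log (∑ y, ω y)).trace.re =
      -(cfc Real.negMulLog (∑ y, ω y)).trace.re := by
    rw [← trace_mul_log_self hB.1, Finset.sum_mul, trace_sum, Complex.re_sum]
  rw [h3, ← Finset.sum_mul, ← Complex.re_sum, ← trace_sum] at h2
  -- The linear terms of Klein's inequality sum to (1 - ∑ ν) times the total trace, which is
  -- nonnegative and can be dropped.
  nlinarith [hB.trace_re_nonneg, mul_nonneg (sub_nonneg.2 hν1) hB.trace_re_nonneg]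

theorem entropy_mul_log_two (A : Matrix n n ℂ) :
    entropy A * Real.log 2 = (cfc Real.negMulLog A).trace.re :=
  div_mul_cancel₀ _ (Real.log_pos one_lt_two).ne'

variable {X Y Z : Type*} [Fintype X] [Fintype Y] [MeasurableSpace Z]

/-- If `Y` is obtained by a classical channel `K` from a register with values in `Z`, then
`I(X : Y | Q)` is bounded by the average relative entropy of `K` with respect to any `ν`. -/
theorem condMutualInfo_mul_log_two_le {μ : X → Measure Z} [∀ x, SFinite (μ x)]
    {Ψ : X → Z → Matrix n n ℂ} (hm : ∀ x i j, Measurable fun z => Ψ x z i j)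
    (hpos : ∀ x z, (Ψ x z).PosSemidef) (hi : ∀ x, Integrable (fun z => (Ψ x z).trace.re) (μ x))
    {K : Y → Z → ℝ} (hK : ∀ y, Measurable (K y)) (hK0 : ∀ y z, 0 ≤ K y z)
    (hK1 : ∀ z, ∑ y, K y z = 1) {ν : Y → ℝ} (hν : ∀ y, 0 ≤ ν y) (hν1 : ∑ y, ν y ≤ 1)
    (hνK : ∀ y z, ν y = 0 → K y z = 0) :
    condMutualInfo (fun x y => matrixIntegral (μ x) fun z => (K y z : ℂ) • Ψ x z) * Real.log 2 ≤
      ∑ x, ∫ z, (∑ y, (K y z * Real.log (K y z) - K y z * Real.log (ν y))) *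
        (Ψ x z).trace.re ∂(μ x) := by
  have hKle : ∀ y z, K y z ≤ 1 := fun y z => by
    rw [← hK1 z]
    exact Finset.single_le_sum (f := fun y => K y z) (fun y _ => hK0 y z) (Finset.mem_univ y)
  have hΨi := fun x => integrable_apply_of_trace (hm x) (hpos x) (hi x)
  have hKΨi : ∀ x y i j, Integrable (fun z => ((K y z : ℂ) • Ψ x z) i j) (μ x) := fun x y i j =>
    integrable_smul_of_bounded (hK y) (hK0 y) (hKle y) (hΨi x i j)
  set ω : X → Y → Matrix n n ℂ := fun x y => matrixIntegral (μ x) fun z => (K y z : ℂ) • Ψ x z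
    with hω
  have hωpos : ∀ x y, (ω x y).PosSemidef := fun x y =>
    posSemidef_matrixIntegral (hKΨi x y) fun z => (hpos x z).smul (by exact_mod_cast hK0 y z)
  have hωsum : ∀ x, ∑ y, ω x y = matrixIntegral (μ x) (Ψ x) := by
    intro x
    ext i j
    rw [Matrix.sum_apply]
    simp only [hω, matrixIntegral, of_apply]
    rw [← integral_finsetSum _ fun y _ => hKΨi x y i j]
    refine integral_congr_ae (.of_forall fun z => ?_)
    simp only [Matrix.smul_apply, smul_eq_mul, ← Finset.sum_mul, ← Complex.ofReal_sum, hK1,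
      Complex.ofReal_one, one_mul]
  have htr : ∀ x y, (ω x y).trace.re = ∫ z, K y z * (Ψ x z).trace.re ∂(μ x) := by
    intro x y
    have := trace_mul_matrixIntegral_re (hKΨi x y) 1
    simpa [hω] using this
  have hKi : ∀ x y, Integrable (fun z => K y z * (Ψ x z).trace.re) (μ x) := fun x y =>
    integrable_weight_mul (hK y) (hK0 y) (hKle y) (hi x)
  have hlogi : ∀ x y, Integrable (fun z => K y z * Real.log (K y z) * (Ψ x z).trace.re) (μ x) := by
    intro x y
    have h1 : Integrable (fun z => Real.negMulLog (K y z) * (Ψ x z).trace.re) (μ x) :=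
      integrable_weight_mul (Real.continuous_negMulLog.measurable.comp (hK y))
        (fun z => Real.negMulLog_nonneg (hK0 y z) (hKle y z))
        (fun z => (Real.negMulLog_le_one_sub_self (hK0 y z)).trans (by linarith [hK0 y z])) (hi x)
    refine h1.neg.congr (.of_forall fun z => ?_)
    simp [Real.negMulLog]
  have hone : ∀ x, (cfc Real.negMulLog (∑ y, ω x y)).trace.re
      - ∑ y, (cfc Real.negMulLog (ω x y)).trace.re ≤
      ∑ y, ∫ z, K y z * Real.log (K y z) * (Ψ x z).trace.re ∂(μ x) := by
    intro x
    have h2 := Finset.sum_le_sum fun y (_ : y ∈ Finset.univ) =>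
      relEntropy_matrixIntegral_le (hm x) (hpos x) (hi x) (hK y) (hK0 y) (hKle y)
    rw [← hωsum x] at h2
    change ∑ y, (-(cfc Real.negMulLog (ω x y)).trace.re -
      (ω x y * cfc Real.log (∑ y, ω x y)).trace.re) ≤ _ at h2
    rw [Finset.sum_sub_distrib, Finset.sum_neg_distrib, ← Complex.re_sum (f := fun y =>
      (ω x y * cfc Real.log (∑ y, ω x y)).trace), ← trace_sum, ← Finset.sum_mul,
      trace_mul_log_self (posSemidef_sum _ fun y _ => hωpos x y).1] at h2
    linarith
  have htwo := sum_trace_negMulLog_sub_le (ω := fun y => ∑ x, ω x y)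
    (fun y => posSemidef_sum _ fun x _ => hωpos x y) hν hν1 (fun y hy => by
      refine Finset.sum_eq_zero fun x _ => ?_
      ext i j
      simp [hω, matrixIntegral, hνK y _ hy])
  have hones := Finset.sum_le_sum fun x (_ : x ∈ Finset.univ) => hone x
  -- Chain rule: minus the contributions S(Y|Q, X = x), plus S(Y|Q).
  have hlhs : condMutualInfo ω * Real.log 2 =
      ∑ x, ((cfc Real.negMulLog (∑ y, ω x y)).trace.re
        - ∑ y, (cfc Real.negMulLog (ω x y)).trace.re)
      + (∑ y, (cfc Real.negMulLog (∑ x, ω x y)).trace.re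
        - (cfc Real.negMulLog (∑ y, ∑ x, ω x y)).trace.re) := by
    simp only [condMutualInfo, cqEntropy, sub_mul, add_mul, Finset.sum_mul, entropy_mul_log_two,
      Fintype.sum_prod_type, Finset.sum_sub_distrib]
    rw [Finset.sum_comm (f := fun x y => ω x y)]
    ring
  have hrhs : ∑ x, ∫ z, (∑ y, (K y z * Real.log (K y z) - K y z * Real.log (ν y))) *
      (Ψ x z).trace.re ∂(μ x) =
      ∑ x, ∑ y, ∫ z, K y z * Real.log (K y z) * (Ψ x z).trace.re ∂(μ x)
        - ∑ y, Real.log (ν y) * (∑ x, ω x y).trace.re := by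
    simp only [trace_sum, Complex.re_sum, htr, Finset.mul_sum]
    rw [Finset.sum_comm (γ := Y) (f := fun y x => Real.log (ν y) * _), ← Finset.sum_sub_distrib]
    refine Finset.sum_congr rfl fun x _ => ?_
    rw [← Finset.sum_sub_distrib]
    have h1 : ∀ y, Integrable (fun z => (K y z * Real.log (K y z) - K y z * Real.log (ν y)) *
        (Ψ x z).trace.re) (μ x) := fun y =>
      ((hlogi x y).sub ((hKi x y).const_mul (Real.log (ν y)))).congr
        (.of_forall fun z => by simp only [Pi.sub_apply]; ring)
    simp only [Finset.sum_mul]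
    rw [integral_finsetSum _ fun y _ => h1 y]
    refine Finset.sum_congr rfl fun y _ => ?_
    rw [← integral_const_mul, ← integral_sub (hlogi x y) ((hKi x y).const_mul _)]
    exact integral_congr_ae (.of_forall fun z => by dsimp only; ring)
  rw [hlhs, hrhs]
  linarith

end CondMutualInfo

/-! ### Positivity of partial traces after a local measurement -/

section PartialTrace

variable {α β : Type*} [Fintype α] [DecidableEq α] [Fintype β] [DecidableEq β]

theorem exists_conjTranspose_mul_self {A : Matrix α α ℂ} (hA : A.PosSemidef) :
    ∃ C : Matrix α α ℂ, A = Cᴴ * C := by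
  refine ⟨diagonal (fun i => (Real.sqrt (hA.1.eigenvalues i) : ℂ)) *
    (hA.1.eigenvectorUnitary : Matrix α α ℂ)ᴴ, ?_⟩
  conv_lhs => rw [eq_mul_diagonal_mul hA.1]
  simp only [conjTranspose_mul, conjTranspose_conjTranspose, diagonal_conjTranspose,
    Matrix.mul_assoc]
  rw [← Matrix.mul_assoc (diagonal _) (diagonal _), diagonal_mul_diagonal]
  congr 3
  ext i
  simp only [Pi.star_apply, Complex.star_def, Complex.conj_ofReal, ← Complex.ofReal_mul,
    Real.mul_self_sqrt (hA.eigenvalues_nonneg i)]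

omit [DecidableEq α] [Fintype β] [DecidableEq β] in
theorem posSemidef_partialTraceLeft {τ : Matrix (α × β) (α × β) ℂ} (hτ : τ.PosSemidef) :
    (partialTraceLeft τ).PosSemidef := by
  have h : partialTraceLeft τ = ∑ i, τ.submatrix (fun j => (i, j)) (fun j => (i, j)) := by
    ext j j'
    simp [partialTraceLeft, Matrix.sum_apply]
  rw [h]
  exact posSemidef_sum _ fun i _ => hτ.submatrix _

omit [DecidableEq α] in
theorem partialTraceLeft_kronecker_mul_apply (F : Matrix α α ℂ) (τ : Matrix (α × β) (α × β) ℂ)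
    (j j' : β) : partialTraceLeft ((F ⊗ₖ (1 : Matrix β β ℂ)) * τ) j j' =
      ∑ i, ∑ i', F i i' * τ (i', j) (i, j') := by
  simp [partialTraceLeft, Matrix.mul_apply, Fintype.sum_prod_type, one_apply]

omit [DecidableEq α] in
theorem partialTraceLeft_kronecker_mul_comm (F : Matrix α α ℂ) (τ : Matrix (α × β) (α × β) ℂ) :
    partialTraceLeft ((F ⊗ₖ (1 : Matrix β β ℂ)) * τ) =
      partialTraceLeft (τ * (F ⊗ₖ (1 : Matrix β β ℂ))) := by
  ext j j'
  rw [partialTraceLeft_kronecker_mul_apply, Finset.sum_comm]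
  simp [partialTraceLeft, Matrix.mul_apply, Fintype.sum_prod_type, one_apply, mul_comm]

/-- With F = CᴴC, cyclicity of the partial trace for operators on the traced factor turns the
product into the congruence (C ⊗ 1)τ(C ⊗ 1)ᴴ. -/
theorem posSemidef_partialTraceLeft_kronecker_mul {F : Matrix α α ℂ} (hF : F.PosSemidef)
    {τ : Matrix (α × β) (α × β) ℂ} (hτ : τ.PosSemidef) :
    (partialTraceLeft ((F ⊗ₖ (1 : Matrix β β ℂ)) * τ)).PosSemidef := by
  obtain ⟨C, rfl⟩ := exists_conjTranspose_mul_self hF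
  have h : (Cᴴ * C) ⊗ₖ (1 : Matrix β β ℂ) = (Cᴴ ⊗ₖ (1 : Matrix β β ℂ)) * (C ⊗ₖ 1) := by
    rw [← mul_kronecker_mul, Matrix.one_mul]
  rw [h, Matrix.mul_assoc, partialTraceLeft_kronecker_mul_comm]
  have h2 : Cᴴ ⊗ₖ (1 : Matrix β β ℂ) = (C ⊗ₖ (1 : Matrix β β ℂ))ᴴ := by
    rw [conjTranspose_kronecker, conjTranspose_one]
  rw [h2]
  exact posSemidef_partialTraceLeft (hτ.mul_mul_conjTranspose_same _)

omit [DecidableEq α] [DecidableEq β] in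
theorem trace_partialTraceLeft (τ : Matrix (α × β) (α × β) ℂ) :
    (partialTraceLeft τ).trace = τ.trace := by
  simp only [trace, partialTraceLeft, diag_apply, of_apply, Fintype.sum_prod_type]
  exact Finset.sum_comm

end PartialTrace

/-! ### Measurement statistics, the input law and the bound on quantized information -/

theorem sum_measureReal_preimage_singleton {H : Type*} [MeasurableSpace H] (μ : Measure H)
    [IsProbabilityMeasure μ] {k : ℕ} {f : H → Fin k} (hf : Measurable f) :
    ∑ y, μ.real (f ⁻¹' {y}) = 1 := by
  rw [← measureReal_biUnion_finset (fun i _ j _ hij =>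
    Disjoint.preimage f (Set.disjoint_singleton.2 hij)) (fun y _ => hf (measurableSet_singleton y))
    (fun y _ => measure_ne_top _ _)]
  have : ⋃ y ∈ (Finset.univ : Finset (Fin k)), f ⁻¹' {y} = Set.univ := by
    ext x; simp
  rw [this, probReal_univ]

section Experiment

variable {ΩA ΩB α β U H : Type*} [MeasurableSpace ΩA] [MeasurableSpace ΩB]
  [Fintype α] [DecidableEq α] [Fintype β] [DecidableEq β]
  [MeasurableSpace U] [MeasurableSpace H] {N : ℕ}

/-- Normalization forces integrability: a nonintegrable diagonal entry would have integral 0 by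
convention instead of 1. The trace then dominates the other entries. -/
theorem Encoder.integrable_effect (E : Encoder ΩA α U N) (a : Fin N → Bool) (r : ΩA) (i j : α) :
    Integrable (fun u => E.effect a r u i j) (E.base a r) := by
  have hdiag : ∀ i, Integrable (fun u => E.effect a r u i i) (E.base a r) := by
    intro i
    by_contra h
    have := E.integral_effect a r i i
    rw [integral_undef h] at this
    simp at this
  have htr : Integrable (fun u => (E.effect a r u).trace.re) (E.base a r) := by
    simp only [trace, diag_apply, Complex.re_sum]
    exact integrable_finsetSum _ fun i _ => (hdiag i).re
  exact integrable_apply_of_trace (fun i j => (E.measurable_effect a i j).comp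
    measurable_prodMk_left) (E.posSemidef_effect a r) htr i j

variable (R : Resource ΩA ΩB α β) (E : Encoder ΩA α U N) (a : Fin N → Bool)

theorem postState_apply (r : ΩA) (s : ΩB) (u : U) (j j' : β) :
    postState R E a r s u j j' = ∑ i, ∑ i', E.effect a r u i i' * R.state r s (i', j) (i, j') :=
  partialTraceLeft_kronecker_mul_apply _ _ _ _

theorem posSemidef_postState (r : ΩA) (s : ΩB) (u : U) : (postState R E a r s u).PosSemidef :=
  posSemidef_partialTraceLeft_kronecker_mul (E.posSemidef_effect a r u) (R.posSemidef_state r s)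

theorem measurable_postState (j j' : β) :
    Measurable fun z : (ΩB × ΩA) × U => postState R E a z.1.2 z.1.1 z.2 j j' := by
  simp only [postState_apply]
  refine Finset.measurable_sum _ fun i _ => Finset.measurable_sum _ fun i' _ => ?_
  have h1 := (E.measurable_effect a i i').comp
    (show Measurable fun z : (ΩB × ΩA) × U => (z.1.2, z.2) by fun_prop)
  have h2 := (R.measurable_state (i', j) (i, j')).comp
    (show Measurable fun z : (ΩB × ΩA) × U => (z.1.2, z.1.1) by fun_prop)
  exact h1.mul h2

theorem measurable_trace_postState :
    Measurable fun z : (ΩB × ΩA) × U => (postState R E a z.1.2 z.1.1 z.2).trace.re := by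
  simp only [trace, diag_apply, Complex.re_sum]
  exact Finset.measurable_sum _ fun j _ => Complex.measurable_re.comp
    (measurable_postState R E a j j)

theorem integrable_postState (r : ΩA) (s : ΩB) (j j' : β) :
    Integrable (fun u => postState R E a r s u j j') (E.base a r) := by
  simp only [postState_apply]
  exact integrable_finsetSum _ fun i _ => integrable_finsetSum _ fun i' _ =>
    (E.integrable_effect a r i i').mul_const _

/-- No signalling: averaged over the outcomes, the decoder's state does not depend on the database.
Its trace gives the normalization of the input law. -/
theorem integral_postState (r : ΩA) (s : ΩB) (j j' : β) :
    ∫ u, postState R E a r s u j j' ∂(E.base a r) = partialTraceLeft (R.state r s) j j' := by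
  simp only [postState_apply]
  rw [integral_finsetSum _ fun i _ => integrable_finsetSum _ fun i' _ =>
    (E.integrable_effect a r i i').mul_const _]
  simp only [partialTraceLeft, of_apply]
  refine Finset.sum_congr rfl fun i _ => ?_
  rw [integral_finsetSum _ fun i' _ => (E.integrable_effect a r i i').mul_const _]
  simp [integral_mul_const, E.integral_effect, one_apply]

theorem lintegral_trace_postState (r : ΩA) (s : ΩB) :
    ∫⁻ u, ENNReal.ofReal (postState R E a r s u).trace.re ∂(E.base a r) = 1 := by
  have hi : Integrable (fun u => (postState R E a r s u).trace.re) (E.base a r) := by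
    simp only [trace, diag_apply, Complex.re_sum]
    exact integrable_finsetSum _ fun j _ => (integrable_postState R E a r s j j).re
  rw [← ofReal_integral_eq_lintegral_ofReal hi
    (.of_forall fun u => (posSemidef_postState R E a r s u).trace_re_nonneg)]
  have h := trace_mul_matrixIntegral_re (integrable_postState R E a r s) 1
  have h2 : matrixIntegral (E.base a r) (postState R E a r s) =
      partialTraceLeft (R.state r s) := by
    ext j j'
    exact integral_postState R E a r s j j'
  simp only [Matrix.one_mul] at h
  rw [← h, h2, trace_partialTraceLeft, R.trace_state]
  simp

theorem lintegral_inputLaw (p : PMF (Fin N → Bool)) {G : U → ℝ≥0∞} (hG : Measurable G) :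
    ∫⁻ u, G u ∂(inputLaw R p E) = ∑ a, p a * ∫⁻ s, ∫⁻ r, ∫⁻ u,
      ENNReal.ofReal (postState R E a r s u).trace.re * G u ∂(E.base a r) ∂(R.lawA s)
        ∂(R.lawB) := by
  have := R.isProbabilityMeasure_lawB
  have := R.isMarkovKernel_lawA
  have := E.isFiniteKernel_base
  rw [inputLaw, lintegral_finsetSum_measure]
  refine Finset.sum_congr rfl fun a _ => ?_
  have hm := (measurable_trace_postState R E a).ennreal_ofReal
  have hF : Measurable fun z : (ΩB × ΩA) × U =>
      ENNReal.ofReal (postState R E a z.1.2 z.1.1 z.2).trace.re * G z.2 :=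
    hm.mul (hG.comp measurable_snd)
  rw [lintegral_smul_measure, smul_eq_mul, Measure.snd, lintegral_map hG measurable_snd,
    lintegral_withDensity_eq_lintegral_mul _ hm (g := fun z => G z.2) (hG.comp measurable_snd)]
  simp only [Pi.mul_apply]
  rw [Measure.lintegral_compProd hF, Measure.lintegral_compProd hF.lintegral_kernel_prod_right']
  simp only [Kernel.prodMkLeft_apply]

theorem inputLaw_univ (p : PMF (Fin N → Bool)) : inputLaw R p E Set.univ = 1 := by
  have := R.isProbabilityMeasure_lawB
  have := R.isMarkovKernel_lawA
  rw [← lintegral_one, lintegral_inputLaw R E p measurable_const]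
  simp only [mul_one, lintegral_trace_postState, lintegral_one, measure_univ]
  exact (tsum_fintype _).symm.trans p.tsum_coe

theorem measurable_postState_section (s : ΩB) (j j' : β) :
    Measurable fun z : ΩA × U => postState R E a z.1 s z.2 j j' := by
  have h := (measurable_postState R E a j j').comp
    (show Measurable fun z : ΩA × U => ((s, z.1), z.2) by fun_prop)
  exact h

theorem measurable_trace_postState_section (s : ΩB) :
    Measurable fun z : ΩA × U => (postState R E a z.1 s z.2).trace.re := by
  have h := (measurable_trace_postState R E a).comp
    (show Measurable fun z : ΩA × U => ((s, z.1), z.2) by fun_prop)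
  exact h
theorem integrable_trace_postState (s : ΩB) [IsProbabilityMeasure (R.lawA s)]
    [IsFiniteKernel (E.base a)] :
    Integrable (fun z : ΩA × U => (postState R E a z.1 s z.2).trace.re)
      (R.lawA s ⊗ₘ E.base a) := by
  refine ⟨(measurable_trace_postState_section R E a s).aestronglyMeasurable, ?_⟩
  have h0 : ∀ z : ΩA × U, 0 ≤ (postState R E a z.1 s z.2).trace.re := fun z =>
    (posSemidef_postState R E a z.1 s z.2).trace_re_nonneg
  rw [hasFiniteIntegral_iff_ofReal (.of_forall h0)]
  have h := Measure.lintegral_compProd (μ := R.lawA s) (κ := E.base a)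
        (measurable_trace_postState_section R E a s).ennreal_ofReal
  simp only [lintegral_trace_postState, lintegral_one, measure_univ] at h
  rw [h]
  exact ENNReal.one_lt_top

theorem ofReal_integral_le_lintegral {Z : Type*} [MeasurableSpace Z] {μ : Measure Z} (f : Z → ℝ) :
    ENNReal.ofReal (∫ z, f z ∂μ) ≤ ∫⁻ z, ENNReal.ofReal (f z) ∂μ := by
  by_cases hf : Integrable f μ
  · have h1 : ∫ z, f z ∂μ ≤ ∫ z, max (f z) 0 ∂μ :=
      integral_mono hf hf.pos_part fun z => le_max_left _ _
    refine (ENNReal.ofReal_le_ofReal h1).trans ?_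
    rw [ofReal_integral_eq_lintegral_ofReal hf.pos_part (.of_forall fun z => le_max_right _ _)]
    simp [ENNReal.ofReal_max]
  · simp [integral_undef hf]

/-- The information transmitted through the quantized representation `f ∘ H` is at most the mean of
any upper bound of the relative entropy of its conditional law given `U` with respect to `ν`. -/
theorem lintegral_condMutualInfo_le (M : Interface U H) (p : PMF (Fin N → Bool)) {k : ℕ}
    {f : H → Fin k} (hf : Measurable f) {ν : Fin k → ℝ} (hν : ∀ y, 0 ≤ ν y)
    (hν1 : ∑ y, ν y ≤ 1) (hνK : ∀ y u, ν y = 0 → (M.channel u).real (f ⁻¹' {y}) = 0)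
    {g : U → ℝ} (hg : Measurable g)
    (hbound : ∀ u, ∑ y, ((M.channel u).real (f ⁻¹' {y}) * Real.log ((M.channel u).real (f ⁻¹' {y}))
      - (M.channel u).real (f ⁻¹' {y}) * Real.log (ν y)) ≤ Real.log 2 * g u) :
    ∫⁻ s, ENNReal.ofReal (condMutualInfo fun (a : Fin N → Bool) (y : Fin k) =>
      ((p a).toReal : ℂ) • outcomeState M R E a s (f ⁻¹' {y})) ∂(R.lawB) ≤
    ∫⁻ u, ENNReal.ofReal (g u) ∂(inputLaw R p E) := by
  have := R.isProbabilityMeasure_lawB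
  have := R.isMarkovKernel_lawA
  have := E.isFiniteKernel_base
  have := M.isMarkovKernel_channel
  have hlog2 : 0 < Real.log 2 := Real.log_pos one_lt_two
  have hKm : ∀ y, Measurable fun u => (M.channel u).real (f ⁻¹' {y}) := fun y =>
    (M.channel.measurable_coe (hf (measurableSet_singleton y))).ennreal_toReal
  have hKsum : ∀ u, ∑ y, (M.channel u).real (f ⁻¹' {y}) = 1 := fun u =>
    sum_measureReal_preimage_singleton _ hf
  have hpt : ∀ s, ENNReal.ofReal (condMutualInfo fun (a : Fin N → Bool) (y : Fin k) =>
      ((p a).toReal : ℂ) • outcomeState M R E a s (f ⁻¹' {y})) ≤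
      ∑ a, p a * ∫⁻ r, ∫⁻ u, ENNReal.ofReal (postState R E a r s u).trace.re *
        ENNReal.ofReal (g u) ∂(E.base a r) ∂(R.lawA s) := by
    intro s
    -- For fixed `s` the classical register is the pair (r, u), and the channel sees only u. The
    -- prior `p a` is absorbed into the state.
    let μ : (Fin N → Bool) → Measure (ΩA × U) := fun a => R.lawA s ⊗ₘ E.base a
    let Ψ : (Fin N → Bool) → ΩA × U → Matrix β β ℂ := fun a z =>
      ((p a).toReal : ℂ) • postState R E a z.1 s z.2
    have hΦm := fun a i j => measurable_postState_section R E a s i j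
    have hΦt := fun a => measurable_trace_postState_section R E a s
    have hΦi := fun a => integrable_trace_postState R E a s
    have hm : ∀ a i j, Measurable fun z => Ψ a z i j := fun a i j => (hΦm a i j).const_mul _
    have hpos : ∀ a z, (Ψ a z).PosSemidef := fun a z =>
      (posSemidef_postState R E a z.1 s z.2).smul (by exact_mod_cast ENNReal.toReal_nonneg)
    have htr : ∀ a z, (Ψ a z).trace.re = (p a).toReal * (postState R E a z.1 s z.2).trace.re :=
      fun a z => by simp only [Ψ, trace_smul, smul_eq_mul, Complex.re_ofReal_mul]
    have hi : ∀ a, Integrable (fun z => (Ψ a z).trace.re) (μ a) := fun a => by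
      simp only [htr]; exact (hΦi a).const_mul _
    have hω : (fun (a : Fin N → Bool) (y : Fin k) =>
        ((p a).toReal : ℂ) • outcomeState M R E a s (f ⁻¹' {y})) = fun a y =>
        matrixIntegral (μ a) fun z => ((M.channel z.2).real (f ⁻¹' {y}) : ℂ) • Ψ a z := by
      ext a y i j
      simp only [matrixIntegral, of_apply, Matrix.smul_apply, smul_eq_mul, outcomeState, Ψ]
      have h1 : Integrable (fun z : ΩA × U => ((M.channel z.2).real (f ⁻¹' {y}) : ℂ) *
          postState R E a z.1 s z.2 i j) (μ a) :=
        integrable_smul_of_bounded ((hKm y).comp measurable_snd) (fun _ => measureReal_nonneg)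
          (fun _ => measureReal_le_one) (integrable_apply_of_trace (hΦm a)
            (fun z => posSemidef_postState R E a z.1 s z.2) (hΦi a) i j)
      rw [← Measure.integral_compProd (μ := R.lawA s) (κ := E.base a) h1, ← integral_const_mul]
      exact integral_congr_ae (.of_forall fun z => by dsimp only; ring)
    have hmain := condMutualInfo_mul_log_two_le (μ := μ) hm hpos hi
      (K := fun y z => (M.channel z.2).real (f ⁻¹' {y})) (fun y => (hKm y).comp measurable_snd)
      (fun _ _ => measureReal_nonneg) (fun z => hKsum z.2) hν hν1 (fun y z => hνK y z.2)
    rw [hω]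
    rw [← le_div_iff₀ hlog2, Finset.sum_div] at hmain
    refine (ENNReal.ofReal_le_ofReal hmain).trans ?_
    -- The summands may be negative, so `ENNReal.ofReal` is only subadditive here; the direction
    -- suffices.
    refine (Finset.le_sum_of_subadditive ENNReal.ofReal ENNReal.ofReal_zero.le
      (fun _ _ => ENNReal.ofReal_add_le) _ _).trans (Finset.sum_le_sum fun a _ => ?_)
    rw [← integral_div]
    refine (ofReal_integral_le_lintegral _).trans ?_
    have hF : Measurable fun z : ΩA × U =>
        ENNReal.ofReal (postState R E a z.1 s z.2).trace.re * ENNReal.ofReal (g z.2) :=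
      (hΦt a).ennreal_ofReal.mul (hg.comp measurable_snd).ennreal_ofReal
    rw [← Measure.lintegral_compProd (μ := R.lawA s) (κ := E.base a) hF,
      ← lintegral_const_mul _ hF]
    refine lintegral_mono fun z => ?_
    have ht := (posSemidef_postState R E a z.1 s z.2).trace_re_nonneg
    have h1 : (∑ y, ((M.channel z.2).real (f ⁻¹' {y}) *
          Real.log ((M.channel z.2).real (f ⁻¹' {y}))
        - (M.channel z.2).real (f ⁻¹' {y}) * Real.log (ν y))) * (Ψ a z).trace.re / Real.log 2 ≤
        (p a).toReal * ((postState R E a z.1 s z.2).trace.re * g z.2) := by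
      rw [div_le_iff₀ hlog2, htr]
      have := mul_le_mul_of_nonneg_right (hbound z.2)
        (mul_nonneg (ENNReal.toReal_nonneg (a := p a)) ht)
      linarith
    refine (ENNReal.ofReal_le_ofReal h1).trans ?_
    rw [ENNReal.ofReal_mul ENNReal.toReal_nonneg, ENNReal.ofReal_mul ht,
      ENNReal.ofReal_toReal (p.apply_ne_top a)]
  refine (lintegral_mono hpt).trans ?_
  rw [lintegral_inputLaw R E p hg.ennreal_ofReal]
  have hmeas : ∀ a, Measurable fun s => ∫⁻ r, ∫⁻ u,
      ENNReal.ofReal (postState R E a r s u).trace.re * ENNReal.ofReal (g u) ∂(E.base a r)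
        ∂(R.lawA s) := by
    intro a
    have hF : Measurable fun z : (ΩB × ΩA) × U =>
        ENNReal.ofReal (postState R E a z.1.2 z.1.1 z.2).trace.re * ENNReal.ofReal (g z.2) :=
      (measurable_trace_postState R E a).ennreal_ofReal.mul (hg.comp measurable_snd).ennreal_ofReal
    have h1 := hF.lintegral_kernel_prod_right' (κ := (E.base a).prodMkLeft ΩB)
    exact h1.lintegral_kernel_prod_right' (κ := R.lawA)
  rw [lintegral_finsetSum _ fun a _ => (hmeas a).const_mul _]
  exact (Finset.sum_congr rfl fun a _ => lintegral_const_mul _ (hmeas a)).le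

end Experiment

/-! ### Finite alphabets and quantized registers -/

section FiniteAlphabet

variable {ΩA ΩB α β U H : Type*} [MeasurableSpace ΩA] [MeasurableSpace ΩB]
  [Fintype α] [DecidableEq α] [Fintype β] [DecidableEq β]
  [MeasurableSpace U] [MeasurableSpace H]

theorem capacity_le_logb_card [Fintype H] (M : Interface U H) (R : Resource ΩA ΩB α β) :
    capacity M R ≤ ENNReal.ofReal (Real.logb 2 (Fintype.card H)) := by
  classical
  refine iSup_le fun N => iSup_le fun p => iSup_le fun E => iSup_le fun _ =>
    iSup_le fun k => iSup_le fun f => iSup_le fun hf => ?_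
  have := M.isMarkovKernel_channel
  set m := (Finset.univ.image f).card with hm
  have hmH : m ≤ Fintype.card H := Finset.card_image_le
  have hoff : ∀ y, y ∉ Finset.univ.image f → f ⁻¹' {y} = ∅ := by
    intro y hy
    ext x
    simp only [Set.mem_preimage, Set.mem_singleton_iff, Set.mem_empty_iff_false, iff_false]
    rintro rfl
    exact hy (Finset.mem_image_of_mem f (Finset.mem_univ x))
  refine (lintegral_condMutualInfo_le R E M p hf
    -- Uniform on the `m` attained values: `k` may exceed the size of the alphabet, and uniformity
    -- on all of `Fin k` would only give log k. As K log K ≤ 0, the divergence is at most log m.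
    (ν := fun y => if y ∈ Finset.univ.image f then (m : ℝ)⁻¹ else 0)
    (fun y => by split_ifs <;> positivity) ?_ ?_
    (g := fun _ => Real.logb 2 (Fintype.card H)) measurable_const fun u => ?_).trans ?_
  · rw [Finset.sum_ite_mem, Finset.univ_inter, Finset.sum_const, nsmul_eq_mul, ← hm]
    exact mul_inv_le_one
  · intro y u hy
    by_cases h : y ∈ Finset.univ.image f
    · simp only [if_pos h, inv_eq_zero, Nat.cast_eq_zero] at hy
      exact absurd h (by rw [Finset.card_eq_zero.1 hy]; simp)
    · rw [hoff y h]; simp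
  · have : Nonempty H := (M.channel u).nonempty_of_neZero
    have hm0 : 0 < m := Finset.card_pos.2 (Finset.univ_nonempty.image f)
    have h1 : ∀ y, (M.channel u).real (f ⁻¹' {y}) * Real.log ((M.channel u).real (f ⁻¹' {y}))
        - (M.channel u).real (f ⁻¹' {y}) *
          Real.log (if y ∈ Finset.univ.image f then (m : ℝ)⁻¹ else 0) ≤
        (M.channel u).real (f ⁻¹' {y}) * Real.log m := by
      intro y
      by_cases h : y ∈ Finset.univ.image f
      · rw [if_pos h, Real.log_inv]
        have := Real.negMulLog_nonneg (x := (M.channel u).real (f ⁻¹' {y})) measureReal_nonneg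
          measureReal_le_one
        rw [Real.negMulLog] at this
        linarith
      · rw [hoff y h]; simp
    refine (Finset.sum_le_sum fun y _ => h1 y).trans ?_
    rw [← Finset.sum_mul, sum_measureReal_preimage_singleton _ hf, one_mul, Real.logb,
      mul_div_cancel₀ _ (Real.log_pos one_lt_two).ne']
    exact Real.log_le_log (by exact_mod_cast hm0) (by exact_mod_cast hmH)
  · rw [lintegral_const, inputLaw_univ, mul_one]

theorem capacity_pi_le {d q : ℕ} {L : Fin d → Type*} [∀ i, MeasurableSpace (L i)]
    [∀ i, Fintype (L i)] (hL : ∀ i, Fintype.card (L i) ≤ 2 ^ q) (M : Interface U (∀ i, L i))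
    (R : Resource ΩA ΩB α β) : capacity M R ≤ ENNReal.ofReal (d * q) := by
  classical
  refine (capacity_le_logb_card M R).trans (ENNReal.ofReal_le_ofReal ?_)
  have h : Fintype.card (∀ i, L i) ≤ 2 ^ (d * q) := by
    rw [Fintype.card_pi, mul_comm, pow_mul]
    exact (Finset.prod_le_prod' fun i _ => hL i).trans (by simp)
  rcases Nat.eq_zero_or_pos (Fintype.card (∀ i, L i)) with h0 | h0
  -- An empty alphabet has `logb 2 0 = 0`.
  · rw [h0]; simp; positivity
  · calc Real.logb 2 (Fintype.card (∀ i, L i)) ≤ Real.logb 2 ((2 : ℝ) ^ (d * q)) :=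
        Real.logb_le_logb_of_le one_lt_two (by exact_mod_cast h0) (by exact_mod_cast h)
      _ = d * q := by rw [Real.logb_pow]; simp

end FiniteAlphabet

/-! ### The ideal real register -/

section RealRegister

variable {n : Type*} [Fintype n] [DecidableEq n]

/-- Follows from the product rule for -x log x, applied to c times an eigenvalue. -/
theorem entropy_smul {ρ : Matrix n n ℂ} (hρ : ρ.IsHermitian) (c : ℝ) :
    entropy ((c : ℂ) • ρ) = c * entropy ρ + Real.negMulLog c * ρ.trace.re / Real.log 2 := by
  have hcont : ∀ f : ℝ → ℝ, ContinuousOn f (spectrum ℝ ρ) := fun f =>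
    Matrix.finite_real_spectrum.continuousOn f
  have h : cfc Real.negMulLog ((c : ℂ) • ρ) =
      c • cfc Real.negMulLog ρ + Real.negMulLog c • ρ := by
    have h1 : (c : ℂ) • ρ = c • ρ := by ext i j; simp
    rw [h1, ← cfc_comp_smul c Real.negMulLog ρ (Real.continuous_negMulLog.continuousOn)
      hρ.isSelfAdjoint]
    have h2 : (fun x : ℝ => Real.negMulLog (c • x)) =
        fun x => c * Real.negMulLog x + Real.negMulLog c * x := by
      ext x; rw [smul_eq_mul, Real.negMulLog_mul]; ring
    rw [h2, cfc_add _ _ _ (hcont _) (hcont _), cfc_const_mul _ _ _ (hcont _),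
      cfc_const_mul _ _ _ (hcont _), cfc_id_eq hρ]
  rw [entropy, entropy, h]
  simp only [trace_add, trace_smul, Complex.add_re, Complex.smul_re, smul_eq_mul]
  ring

theorem entropy_zero : entropy (0 : Matrix n n ℂ) = 0 := by
  simp [entropy, cfc_apply_zero]

/-- A uniform register `X` that determines `Y` bijectively carries `log |X|` bits. -/
theorem condMutualInfo_uniform {X Y : Type*} [Fintype X] [Fintype Y] [DecidableEq Y] [Nonempty X]
    (e : X ≃ Y) {ρ : Matrix n n ℂ} (hρ : ρ.IsHermitian) (htr : ρ.trace = 1) :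
    condMutualInfo (fun x y => (((Fintype.card X : ℝ)⁻¹ : ℝ) : ℂ) • if e x = y then ρ else 0) =
      Real.logb 2 (Fintype.card X) := by
  have hK : (Fintype.card X : ℝ) ≠ 0 := by exact_mod_cast Fintype.card_ne_zero
  set c : ℝ := (Fintype.card X : ℝ)⁻¹ with hc
  have h1 : ∀ x, ∑ y, ((c : ℂ) • if e x = y then ρ else 0) = (c : ℂ) • ρ := by
    intro x; rw [← Finset.smul_sum]; simp
  have h2 : ∀ y, ∑ x, ((c : ℂ) • if e x = y then ρ else 0) = (c : ℂ) • ρ := by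
    intro y
    rw [← Finset.smul_sum, ← e.symm.sum_comp]
    simp
  have h3 : ∑ _x : X, (c : ℂ) • ρ = ρ := by
    rw [Finset.sum_const, Finset.card_univ, ← Nat.cast_smul_eq_nsmul ℂ, smul_smul]
    have : (Fintype.card X : ℂ) * (c : ℂ) = 1 := by
      rw [hc]; push_cast
      exact mul_inv_cancel₀ (by exact_mod_cast hK)
    rw [this, one_smul]
  have h4 : ∀ x y, entropy ((c : ℂ) • if e x = y then ρ else 0) =
      if e x = y then entropy ((c : ℂ) • ρ) else 0 := by
    intro x y; split_ifs
    · rfl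
    · rw [smul_zero, entropy_zero]
  have hcard : (Fintype.card Y : ℝ) = Fintype.card X := by rw [Fintype.card_congr e]
  simp only [condMutualInfo, cqEntropy, Fintype.sum_prod_type, h4, h1, h2, h3,
    Finset.sum_ite_eq, Finset.mem_univ, if_true, Finset.sum_const, Finset.card_univ, nsmul_eq_mul,
    hcard]
  rw [entropy_smul hρ, htr, Real.negMulLog, hc, Real.log_inv, Real.logb, Complex.one_re]
  field_simp
  ring

variable {ΩA ΩB α β : Type*} [MeasurableSpace ΩA] [MeasurableSpace ΩB]
  [Fintype α] [DecidableEq α] [Fintype β] [DecidableEq β]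

/-- The encoder that ignores its share and writes a function of the database. -/
noncomputable def deterministicEncoder {U : Type*} [MeasurableSpace U] {N : ℕ}
    (enc : (Fin N → Bool) → U) : Encoder ΩA α U N where
  base a := Kernel.const ΩA (Measure.dirac (enc a))
  isFiniteKernel_base _ := inferInstance
  effect _ _ _ := 1
  measurable_effect _ _ _ := measurable_const
  posSemidef_effect _ _ _ := PosSemidef.one
  integral_effect a r i j := by simp

theorem postState_deterministicEncoder {U : Type*} [MeasurableSpace U] {N : ℕ}
    (enc : (Fin N → Bool) → U) (R : Resource ΩA ΩB α β) (a : Fin N → Bool) (r : ΩA) (s : ΩB)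
    (u : U) : postState R (deterministicEncoder enc) a r s u = partialTraceLeft (R.state r s) := by
  simp [postState, deterministicEncoder]

/-- State of the quantum part of the share of the decoder, given its classical part. -/
noncomputable def Resource.marginalB (R : Resource ΩA ΩB α β) (s : ΩB) : Matrix β β ℂ :=
  matrixIntegral (R.lawA s) fun r => partialTraceLeft (R.state r s)

omit [DecidableEq α] [DecidableEq β] in
theorem Resource.integrable_partialTraceLeft (R : Resource ΩA ΩB α β) (s : ΩB) (i j : β) :
    Integrable (fun r => partialTraceLeft (R.state r s) i j) (R.lawA s) := by
  have := R.isMarkovKernel_lawA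
  refine integrable_apply_of_trace (Φ := fun r => partialTraceLeft (R.state r s)) (fun i j => ?_)
    (fun r => posSemidef_partialTraceLeft (R.posSemidef_state r s)) ?_ i j
  · simp only [partialTraceLeft, of_apply]
    exact Finset.measurable_sum _ fun k _ =>
      (R.measurable_state (k, i) (k, j)).comp measurable_prodMk_right
  · simp only [trace_partialTraceLeft, R.trace_state]
    exact integrable_const _

omit [DecidableEq α] [DecidableEq β] in
theorem Resource.posSemidef_marginalB (R : Resource ΩA ΩB α β) (s : ΩB) :
    (R.marginalB s).PosSemidef :=
  posSemidef_matrixIntegral (R.integrable_partialTraceLeft s)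
    fun r => posSemidef_partialTraceLeft (R.posSemidef_state r s)

omit [DecidableEq α] in
theorem Resource.trace_marginalB (R : Resource ΩA ΩB α β) (s : ΩB) :
    (R.marginalB s).trace = 1 := by
  have := R.isMarkovKernel_lawA
  have h := trace_mul_matrixIntegral (R.integrable_partialTraceLeft s) 1
  simp only [Matrix.one_mul, trace_partialTraceLeft, R.trace_state] at h
  rw [Resource.marginalB, h]
  simp

theorem outcomeState_realRegister {d N : ℕ} (enc : (Fin N → Bool) → Fin d → ℝ)
    (R : Resource ΩA ΩB α β) (a : Fin N → Bool) (s : ΩB) {S : Set (Fin d → ℝ)}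
    (hS : MeasurableSet S) [Decidable (enc a ∈ S)] :
    outcomeState (realRegister d) R (deterministicEncoder enc) a s S =
      if enc a ∈ S then R.marginalB s else 0 := by
  ext i j
  simp only [outcomeState, of_apply, postState_deterministicEncoder]
  have h : ∀ r, ∫ u, (((realRegister d).channel u).real S : ℂ) *
      partialTraceLeft (R.state r s) i j ∂((deterministicEncoder enc : Encoder ΩA α _ N).base a r) =
      (if enc a ∈ S then 1 else 0) * partialTraceLeft (R.state r s) i j := by
    intro r
    simp only [deterministicEncoder, Kernel.const_apply, integral_dirac, realRegister,
      Kernel.id_apply, Measure.real, Measure.dirac_apply' _ hS]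
    by_cases hm : enc a ∈ S <;> simp [hm]
  simp only [h]
  split_ifs <;> simp [Resource.marginalB, matrixIntegral]

/-- A uniform database of N bits is written as its index, an integer repeated in every coordinate.
The floor of one coordinate recovers it, so N bits are transmitted whatever the decoder's share is.
-/
theorem capacity_realRegister {d : ℕ} (hd : 1 ≤ d) (R : Resource ΩA ΩB α β) :
    capacity (realRegister d) R = ⊤ := by
  classical
  have := R.isProbabilityMeasure_lawB
  suffices h : ∀ N : ℕ, (N : ℝ≥0∞) ≤ capacity (realRegister d) R by
    by_contra hne
    obtain ⟨N, hN⟩ := ENNReal.exists_nat_gt hne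
    exact absurd (h N) (not_le.2 hN)
  intro N
  let k := Fintype.card (Fin N → Bool)
  have hk : 0 < k := Fintype.card_pos
  let e : (Fin N → Bool) ≃ Fin k := Fintype.equivFin _
  let enc : (Fin N → Bool) → Fin d → ℝ := fun a _ => ((e a : ℕ) : ℝ)
  -- The default outside the range only makes the quantizer total; codewords never reach it.
  let g : ℕ → Fin k := fun m => if h : m < k then ⟨m, h⟩ else ⟨0, hk⟩
  let f : (Fin d → ℝ) → Fin k := fun x => g ⌊x ⟨0, hd⟩⌋₊
  have hf : Measurable f :=
    (measurable_from_nat (f := g)).comp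
      (Nat.measurable_floor.comp (measurable_pi_apply (⟨0, hd⟩ : Fin d)))
  have hfe : ∀ a, f (enc a) = e a := by
    intro a
    simp [f, enc, g]
  let p : PMF (Fin N → Bool) := PMF.uniformOfFintype _
  have hp : ∀ a, (p a).toReal = (Fintype.card (Fin N → Bool) : ℝ)⁻¹ := by
    intro a; simp [p]
  refine le_trans ?_ (le_iSup_of_le N <| le_iSup_of_le p <|
    le_iSup_of_le (deterministicEncoder enc) <| le_iSup_of_le (Set.mem_univ _) <|
    le_iSup_of_le k <| le_iSup_of_le f <| le_iSup_of_le hf le_rfl)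
  have h : ∀ s, (N : ℝ≥0∞) = ENNReal.ofReal (condMutualInfo fun (a : Fin N → Bool) (y : Fin k) =>
      ((p a).toReal : ℂ) • outcomeState (realRegister d) R (deterministicEncoder enc) a s
        (f ⁻¹' {y})) := by
    intro s
    have h1 := condMutualInfo_uniform e (R.posSemidef_marginalB s).1 (R.trace_marginalB s)
    have h2 : Real.logb 2 (Fintype.card (Fin N → Bool)) = N := by
      simp [Real.logb_pow]
    rw [h2] at h1
    rw [← ENNReal.ofReal_natCast, ← h1]
    congr 2
    ext1 a
    ext1 y
    rw [hp, outcomeState_realRegister enc R a s (hf (measurableSet_singleton y))]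
    simp only [Set.mem_preimage, Set.mem_singleton_iff, hfe]
  simp only [← h, lintegral_const, measure_univ, mul_one, le_refl]

end RealRegister

/-! ### Classical data processing under quantization -/

section DataProcessing

variable {H : Type*} [MeasurableSpace H] {κ ρ : Measure H} [IsProbabilityMeasure κ]
  [IsProbabilityMeasure ρ] {l : H → ℝ}

omit [IsProbabilityMeasure κ] in
theorem measureReal_eq_zero_of_withDensity_exp_neg (hl : Measurable l)
    (hd : κ.withDensity (fun h => ENNReal.ofReal (Real.exp (-l h))) = ρ) {S : Set H}
    (h0 : ρ.real S = 0) : κ.real S = 0 := by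
  have h1 : ρ S = 0 := (measureReal_eq_zero_iff).1 h0
  have hm : Measurable fun h => ENNReal.ofReal (Real.exp (-l h)) := by fun_prop
  rw [← hd, withDensity_apply_eq_zero hm] at h1
  have h2 : {x | ENNReal.ofReal (Real.exp (-l x)) ≠ 0} ∩ S = S := by
    ext x; simp [Real.exp_pos]
  rw [h2] at h1
  simp [Measure.real, h1]

/-- Log-sum inequality on a cell of a quantization. -/
theorem mul_log_sub_mul_log_le_setIntegral (hl : Measurable l) (hli : Integrable l κ)
    (hd : κ.withDensity (fun h => ENNReal.ofReal (Real.exp (-l h))) = ρ) {S : Set H}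
    (hS : MeasurableSet S) :
    κ.real S * Real.log (κ.real S) - κ.real S * Real.log (ρ.real S) ≤ ∫ h in S, l h ∂κ := by
  rcases eq_or_lt_of_le (measureReal_nonneg (μ := κ) (s := S)) with h0 | h0
  · have h1 : κ S = 0 := (measureReal_eq_zero_iff).1 h0.symm
    rw [← h0, Measure.restrict_eq_zero.2 h1]
    simp
  have hρ : 0 < ρ.real S := by
    refine lt_of_le_of_ne measureReal_nonneg fun h => h0.ne' ?_
    exact measureReal_eq_zero_of_withDensity_exp_neg hl hd h.symm
  have hlin : ∫⁻ h in S, ENNReal.ofReal (Real.exp (-l h)) ∂κ = ρ S := by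
    rw [← hd, withDensity_apply _ hS]
  have hexp : Integrable (fun h => Real.exp (-l h)) (κ.restrict S) := by
    refine ⟨by fun_prop, ?_⟩
    rw [hasFiniteIntegral_iff_ofReal (.of_forall fun h => (Real.exp_pos _).le), hlin]
    exact measure_lt_top _ _
  have hint : ∫ h in S, Real.exp (-l h) ∂κ = ρ.real S := by
    rw [integral_eq_lintegral_of_nonneg_ae (.of_forall fun h => (Real.exp_pos _).le)
      hexp.aestronglyMeasurable, hlin, Measure.real]
  set c := κ.real S / ρ.real S with hc
  have hc0 : 0 < c := div_pos h0 hρ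
  -- Tangent-line bound for the exponential. Integrated over the cell, the choice c = κ(S)/ρ(S)
  -- cancels the linear terms and leaves κ(S) log c.
  have hpt : ∀ h, Real.log c + 1 - c * Real.exp (-l h) ≤ l h := by
    intro h
    have := Real.add_one_le_exp (Real.log c - l h)
    rw [sub_eq_add_neg, Real.exp_add, Real.exp_log hc0] at this
    linarith
  have hmono := integral_mono (μ := κ.restrict S)
    ((integrable_const (Real.log c + 1)).sub (hexp.const_mul c)) hli.integrableOn hpt
  simp only [Pi.sub_apply] at hmono
  rw [integral_sub (integrable_const _) (hexp.const_mul c), integral_const_mul, hint,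
    setIntegral_const, smul_eq_mul, hc, div_mul_cancel₀ _ hρ.ne',
    Real.log_div h0.ne' hρ.ne'] at hmono
  linarith

/-- Quantization does not increase relative entropy. -/
theorem sum_mul_log_sub_le_integral (hl : Measurable l) (hli : Integrable l κ)
    (hd : κ.withDensity (fun h => ENNReal.ofReal (Real.exp (-l h))) = ρ) {k : ℕ} {f : H → Fin k}
    (hf : Measurable f) :
    ∑ y, (κ.real (f ⁻¹' {y}) * Real.log (κ.real (f ⁻¹' {y})) -
      κ.real (f ⁻¹' {y}) * Real.log (ρ.real (f ⁻¹' {y}))) ≤ ∫ h, l h ∂κ := by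
  have hS : ∀ y, MeasurableSet (f ⁻¹' {y}) := fun y => hf (measurableSet_singleton y)
  refine (Finset.sum_le_sum fun y _ => mul_log_sub_mul_log_le_setIntegral hl hli hd (hS y)).trans ?_
  rw [← integral_iUnion_fintype hS (fun i j hij => Disjoint.preimage f
    (Set.disjoint_singleton.2 hij)) fun y => hli.integrableOn]
  have : ⋃ y, f ⁻¹' {y} = Set.univ := by ext x; simp
  rw [this, Measure.restrict_univ]

end DataProcessing

/-! ### Gaussian divergences and the power-constrained channel -/

section Gaussian

/-- It suffices to compare boxes; there the integrand is a product of functions of independent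
coordinates. -/
theorem pi_withDensity {ι : Type*} [Fintype ι] {X : ι → Type*} [∀ i, MeasurableSpace (X i)]
    (μ : ∀ i, Measure (X i)) [∀ i, IsProbabilityMeasure (μ i)] {f : ∀ i, X i → ℝ≥0∞}
    (hf : ∀ i, Measurable (f i)) [∀ i, SigmaFinite ((μ i).withDensity (f i))] :
    (Measure.pi μ).withDensity (fun x => ∏ i, f i (x i)) =
      Measure.pi fun i => (μ i).withDensity (f i) := by
  refine (Measure.pi_eq fun s hs => ?_).symm
  have hind : ∀ i, Measurable ((s i).indicator (f i)) := fun i => (hf i).indicator (hs i)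
  rw [withDensity_apply _ (.univ_pi hs), ← lintegral_indicator (.univ_pi hs)]
  have h1 : (Set.univ.pi s).indicator (fun x => ∏ i, f i (x i)) =
      fun x => ∏ i, (s i).indicator (f i) (x i) := by
    ext x
    by_cases hx : x ∈ Set.univ.pi s
    · rw [Set.indicator_of_mem hx]
      exact Finset.prod_congr rfl fun i _ => (Set.indicator_of_mem (hx i trivial) _).symm
    · rw [Set.indicator_of_notMem hx]
      simp only [Set.mem_pi, Set.mem_univ, true_implies, not_forall] at hx
      obtain ⟨i, hi⟩ := hx
      exact (Finset.prod_eq_zero (Finset.mem_univ i) (Set.indicator_of_notMem hi _)).symm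
  rw [h1, lintegral_prod_eq_prod_lintegral_of_indepFun Finset.univ
    (fun i (x : ∀ i, X i) => (s i).indicator (f i) (x i))
    (iIndepFun_pi fun i => (hind i).aemeasurable) fun i => (hind i).comp (measurable_pi_apply i)]
  refine Finset.prod_congr rfl fun i _ => ?_
  rw [(measurePreserving_eval μ i).lintegral_comp (hind i), lintegral_indicator (hs i),
    withDensity_apply _ (hs i)]

open scoped NNReal

/-- Logarithmic likelihood ratio of `𝒩(m, v)` and `𝒩(0, w)`. -/
noncomputable def gaussianLogRatio (m : ℝ) (v w : ℝ≥0) (x : ℝ) : ℝ :=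
  Real.log (w / v) / 2 - (x - m) ^ 2 / (2 * v) + x ^ 2 / (2 * w)

theorem measurable_gaussianLogRatio (m : ℝ) (v w : ℝ≥0) : Measurable (gaussianLogRatio m v w) := by
  unfold gaussianLogRatio; fun_prop

theorem gaussianPDFReal_mul_exp (m : ℝ) {v w : ℝ≥0} (hv : v ≠ 0) (hw : w ≠ 0) (x : ℝ) :
    gaussianPDFReal m v x * Real.exp (-gaussianLogRatio m v w x) = gaussianPDFReal 0 w x := by
  have hv' : (0 : ℝ) < v := by positivity
  have hw' : (0 : ℝ) < w := by positivity
  have h1 : Real.exp (-(Real.log (w / v) / 2)) = √v / √w := by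
    rw [← Real.log_sqrt (by positivity), Real.exp_neg, Real.exp_log (by positivity),
      Real.sqrt_div hw'.le, inv_div]
  have h2 : -gaussianLogRatio m v w x = -(Real.log (w / v) / 2) + ((x - m) ^ 2 / (2 * v)) +
      (-(x - 0) ^ 2 / (2 * w)) := by
    unfold gaussianLogRatio; ring
  rw [h2, Real.exp_add, Real.exp_add, h1, gaussianPDFReal, gaussianPDFReal, neg_div, Real.exp_neg,
    Real.sqrt_mul (by positivity : (0 : ℝ) ≤ 2 * Real.pi) v,
    Real.sqrt_mul (by positivity : (0 : ℝ) ≤ 2 * Real.pi) w]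
  have := Real.sqrt_pos.2 hv'
  have := Real.sqrt_pos.2 hw'
  have := Real.exp_pos ((x - m) ^ 2 / (2 * v))
  field_simp

theorem gaussianReal_withDensity (m : ℝ) {v w : ℝ≥0} (hv : v ≠ 0) (hw : w ≠ 0) :
    (gaussianReal m v).withDensity
      (fun x => ENNReal.ofReal (Real.exp (-gaussianLogRatio m v w x))) = gaussianReal 0 w := by
  have hm := measurable_gaussianLogRatio m v w
  rw [gaussianReal_of_var_ne_zero m hv, gaussianReal_of_var_ne_zero 0 hw,
    ← withDensity_mul _ (measurable_gaussianPDF m v) (by fun_prop)]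
  congr 1
  ext x
  rw [Pi.mul_apply, gaussianPDF, gaussianPDF, ← ENNReal.ofReal_mul (gaussianPDFReal_nonneg _ _ _),
    gaussianPDFReal_mul_exp m hv hw]

theorem integrable_sq_sub_gaussianReal (m c : ℝ) (v : ℝ≥0) :
    Integrable (fun x => (x - c) ^ 2) (gaussianReal m v) :=
  ((memLp_id_gaussianReal (μ := m) (v := v) 2).sub (memLp_const c)).integrable_sq

theorem integral_sq_sub_gaussianReal (m : ℝ) (v : ℝ≥0) :
    ∫ x, (x - m) ^ 2 ∂(gaussianReal m v) = v := by
  have h := variance_id_gaussianReal (μ := m) (v := v)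
  rw [variance_eq_integral aemeasurable_id] at h
  simpa [integral_id_gaussianReal] using h

theorem integral_sq_gaussianReal (m : ℝ) (v : ℝ≥0) :
    ∫ x, x ^ 2 ∂(gaussianReal m v) = m ^ 2 + v := by
  have h := variance_eq_sub (memLp_id_gaussianReal (μ := m) (v := v) 2)
  rw [variance_id_gaussianReal] at h
  simp only [id, Pi.pow_apply, integral_id_gaussianReal] at h
  linarith

theorem integrable_gaussianLogRatio (m : ℝ) (v w : ℝ≥0) :
    Integrable (gaussianLogRatio m v w) (gaussianReal m v) := by
  have h1 := (integrable_sq_sub_gaussianReal m m v).div_const (2 * v)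
  have h2 := (integrable_sq_sub_gaussianReal m 0 v).div_const (2 * w)
  simp only [sub_zero] at h2
  exact ((integrable_const _).sub h1).add h2

theorem integral_gaussianLogRatio (m : ℝ) {v : ℝ≥0} (hv : v ≠ 0) (w : ℝ≥0) :
    ∫ x, gaussianLogRatio m v w x ∂(gaussianReal m v) =
      Real.log (w / v) / 2 - 1 / 2 + (m ^ 2 + v) / (2 * w) := by
  have h1 := (integrable_sq_sub_gaussianReal m m v).div_const (2 * v)
  have h2 := (integrable_sq_sub_gaussianReal m 0 v).div_const (2 * w)
  simp only [sub_zero] at h2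
  have h3 : Integrable (fun x => Real.log (w / v) / 2 - (x - m) ^ 2 / (2 * v)) (gaussianReal m v) :=
    (integrable_const _).sub h1
  simp only [gaussianLogRatio]
  rw [integral_add h3 h2, integral_sub (integrable_const _) h1, integral_const,
    integral_div, integral_div,
    integral_sq_sub_gaussianReal, integral_sq_gaussianReal]
  have : (v : ℝ) ≠ 0 := by exact_mod_cast hv
  simp only [probReal_univ, one_smul]
  field_simp

theorem awgn_channel_apply (d : ℕ) (P σ : ℝ) (u : Fin d → ℝ) :
    (awgn d P σ).channel u = Measure.pi fun i => gaussianReal (u i) (σ ^ 2).toNNReal := by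
  have h1 : (awgn d P σ).channel u = (gaussianNoise d σ).map (fun z => u + z) := by
    simp only [awgn]
    rw [Kernel.map_apply _ (by fun_prop), Kernel.prod_apply, Kernel.id_apply, Kernel.const_apply,
      Measure.dirac_prod, Measure.map_map (by fun_prop) (by fun_prop)]
    rfl
  rw [h1, gaussianNoise]
  have h2 := Measure.pi_map_pi (μ := fun _ : Fin d => gaussianReal 0 (σ ^ 2).toNNReal)
    (f := fun i x => u i + x) (fun i => by fun_prop)
  simp only [gaussianReal_map_const_add, zero_add] at h2
  exact h2

variable {ΩA ΩB α β : Type*} [MeasurableSpace ΩA] [MeasurableSpace ΩB]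
  [Fintype α] [DecidableEq α] [Fintype β] [DecidableEq β]

/-- Likelihood ratio and relative entropy of a Gaussian vector with respect to a centered one. -/
theorem gaussian_pi_withDensity_and_integral {d : ℕ} (u : Fin d → ℝ) {v w : ℝ≥0}
    (hv : v ≠ 0) (hw : w ≠ 0) :
    (Measure.pi fun i => gaussianReal (u i) v).withDensity (fun h =>
      ENNReal.ofReal (Real.exp (-∑ i, gaussianLogRatio (u i) v w (h i)))) =
        Measure.pi (fun _ : Fin d => gaussianReal 0 w) ∧
    Integrable (fun h : Fin d → ℝ => ∑ i, gaussianLogRatio (u i) v w (h i))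
      (Measure.pi fun i => gaussianReal (u i) v) ∧
    ∫ h, ∑ i, gaussianLogRatio (u i) v w (h i) ∂(Measure.pi fun i => gaussianReal (u i) v) =
      d * (Real.log (w / v) / 2 - 1 / 2 + v / (2 * w)) + (∑ i, u i ^ 2) / (2 * w) := by
  have hi : ∀ i, Integrable (fun h : Fin d → ℝ => gaussianLogRatio (u i) v w (h i))
      (Measure.pi fun i => gaussianReal (u i) v) := fun i =>
    (measurePreserving_eval (fun i => gaussianReal (u i) v) i).integrable_comp_of_integrable
      (integrable_gaussianLogRatio (u i) v w)
  refine ⟨?_, integrable_finsetSum _ fun i _ => hi i, ?_⟩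
  · have hd := fun i => gaussianReal_withDensity (u i) hv hw
    have : ∀ i, SigmaFinite ((gaussianReal (u i) v).withDensity
      (fun x => ENNReal.ofReal (Real.exp (-gaussianLogRatio (u i) v w x)))) := fun i => by
        rw [hd i]; infer_instance
    have h := pi_withDensity (fun i => gaussianReal (u i) v)
      (f := fun i x => ENNReal.ofReal (Real.exp (-gaussianLogRatio (u i) v w x)))
      (fun i => (measurable_gaussianLogRatio (u i) v w).neg.exp.ennreal_ofReal)
    simp only [hd] at h
    rw [← h]
    congr 1
    ext x
    rw [← Finset.sum_neg_distrib, Real.exp_sum,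
      ENNReal.ofReal_prod_of_nonneg fun i _ => (Real.exp_pos _).le]
  · rw [integral_finsetSum _ fun i _ => hi i]
    have h1 : ∀ i, ∫ h : Fin d → ℝ, gaussianLogRatio (u i) v w (h i)
        ∂(Measure.pi fun i => gaussianReal (u i) v) =
        (Real.log (w / v) / 2 - 1 / 2 + v / (2 * w)) + u i ^ 2 / (2 * w) := by
      intro i
      rw [← integral_map (f := gaussianLogRatio (u i) v w) (φ := fun h : Fin d → ℝ => h i)
        (measurable_pi_apply i).aemeasurable
        (measurable_gaussianLogRatio (u i) v w).aestronglyMeasurable,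
        (measurePreserving_eval (fun i => gaussianReal (u i) v) i).map_eq,
        integral_gaussianLogRatio _ hv]
      ring
    simp only [h1, Finset.sum_add_distrib, Finset.sum_const, Finset.card_univ, Fintype.card_fin,
      nsmul_eq_mul, Finset.sum_div]
    ring

/-- The reference has variance w = σ² + P in each coordinate. With v = σ², the mean of ‖u‖²/(2w) is
at most d(w - v)/(2w), which cancels the constants -d/2 + dv/(2w) of the divergence and leaves (d/2)
log(w/v). -/
theorem capacity_awgn_le (d : ℕ) {P σ : ℝ} (hP : 0 ≤ P) (hσ : 0 < σ) (R : Resource ΩA ΩB α β) :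
    capacity (awgn d P σ) R ≤ ENNReal.ofReal (d / 2 * Real.logb 2 (1 + P / σ ^ 2)) := by
  refine iSup_le fun N => iSup_le fun p => iSup_le fun E => iSup_le fun hE =>
    iSup_le fun k => iSup_le fun f => iSup_le fun hf => ?_
  obtain ⟨v, hv⟩ : ∃ v, v = (σ ^ 2).toNNReal := ⟨_, rfl⟩
  obtain ⟨w, hw⟩ : ∃ w, w = (σ ^ 2 + P).toNNReal := ⟨_, rfl⟩
  have hσ2 : 0 < σ ^ 2 := by positivity
  have hvr : (v : ℝ) = σ ^ 2 := by rw [hv, Real.coe_toNNReal _ hσ2.le]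
  have hwr : (w : ℝ) = σ ^ 2 + P := by rw [hw, Real.coe_toNNReal _ (by positivity)]
  have hvp : (0 : ℝ) < v := by rw [hvr]; exact hσ2
  have hwp : (0 : ℝ) < w := by rw [hwr]; positivity
  have hv0 : v ≠ 0 := by rintro rfl; simp at hvp
  have hw0 : w ≠ 0 := by rintro rfl; simp at hwp
  have hlog2 : 0 < Real.log 2 := Real.log_pos one_lt_two
  obtain ⟨C, hC⟩ : ∃ C, C = d * (Real.log (w / v) / 2 - 1 / 2 + v / (2 * w)) / Real.log 2 :=
    ⟨_, rfl⟩
  -- The divergence at u = 0, in bits. Its sign follows from 1 - 1/x ≤ log x at x = w/v and is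
  -- needed to split `ENNReal.ofReal` of the sum.
  have hC0 : 0 ≤ C := by
    have h := Real.one_sub_inv_le_log_of_pos (div_pos hwp hvp)
    have h2 : (w / v : ℝ)⁻¹ = 2 * (v / (2 * w)) := by field_simp
    rw [h2] at h
    rw [hC]
    refine div_nonneg (mul_nonneg (by positivity) (by linarith)) hlog2.le
  have hb0 : 0 ≤ (2 * w * Real.log 2)⁻¹ := by positivity
  have hch : ∀ u, (awgn d P σ).channel u = Measure.pi fun i => gaussianReal (u i) v := fun u => by
    rw [awgn_channel_apply, hv]
  have hlm : ∀ u : Fin d → ℝ,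
      Measurable fun h : Fin d → ℝ => ∑ i, gaussianLogRatio (u i) v w (h i) := fun u =>
    Finset.measurable_sum _ fun i _ =>
      (measurable_gaussianLogRatio (u i) v w).comp (measurable_pi_apply i)
  refine (lintegral_condMutualInfo_le R E (awgn d P σ) p hf
    (ν := fun y => (Measure.pi fun _ : Fin d => gaussianReal 0 w).real (f ⁻¹' {y}))
    (fun y => measureReal_nonneg) (sum_measureReal_preimage_singleton _ hf).le ?_
    (g := fun u => C + (2 * w * Real.log 2)⁻¹ * ∑ i, u i ^ 2) (by fun_prop) fun u => ?_).trans ?_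
  · intro y u h0
    rw [hch]
    exact measureReal_eq_zero_of_withDensity_exp_neg (hlm u)
      (gaussian_pi_withDensity_and_integral u hv0 hw0).1 h0
  · obtain ⟨h1, h2, h3⟩ := gaussian_pi_withDensity_and_integral u hv0 hw0
    rw [hch]
    refine (sum_mul_log_sub_le_integral (hlm u) h2 h1 hf).trans ?_
    rw [h3, hC]
    apply le_of_eq
    field_simp
  · have h1 : ∀ u : Fin d → ℝ, ENNReal.ofReal (C + (2 * w * Real.log 2)⁻¹ * ∑ i, u i ^ 2) =
        ENNReal.ofReal C + ENNReal.ofReal (2 * w * Real.log 2)⁻¹ *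
          ENNReal.ofReal (∑ i, u i ^ 2) := by
      intro u
      rw [ENNReal.ofReal_add hC0 (mul_nonneg hb0 (Finset.sum_nonneg fun i _ => sq_nonneg _)),
        ENNReal.ofReal_mul hb0]
    simp only [h1]
    rw [lintegral_add_left measurable_const, lintegral_const, inputLaw_univ, mul_one,
      lintegral_const_mul _ (by fun_prop)]
    have hE' : ∫⁻ u, ENNReal.ofReal (∑ i, u i ^ 2) ∂(inputLaw R p E) ≤ ENNReal.ofReal (d * P) := hE
    refine (add_le_add le_rfl (mul_le_mul_right hE' _)).trans ?_
    rw [← ENNReal.ofReal_mul hb0, ← ENNReal.ofReal_add hC0 (by positivity)]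
    refine ENNReal.ofReal_le_ofReal (le_of_eq ?_)
    have h2 : (w / v : ℝ) = 1 + P / σ ^ 2 := by rw [hwr, hvr]; field_simp
    rw [hC, ← h2, Real.logb]
    have hP' : P = w - v := by rw [hwr, hvr]; ring
    rw [hP']
    field_simp
    ring

end Gaussian

end NeuralIC

theorem proposition1 {ΩA ΩB α β : Type*} [MeasurableSpace ΩA] [MeasurableSpace ΩB]
    [Fintype α] [DecidableEq α] [Fintype β] [DecidableEq β]
    (R : NeuralIC.Resource ΩA ΩB α β) :
    -- the representation takes values in a finite alphabet
    (∀ (U H : Type*) [MeasurableSpace U] [MeasurableSpace H] [Fintype H]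
      (M : NeuralIC.Interface U H),
      NeuralIC.capacity M R ≤ ENNReal.ofReal (Real.logb 2 (Fintype.card H))) ∧
    -- the representation has `d` coordinates, each quantized to `q` bits
    (∀ (d q : ℕ) (U : Type*) (L : Fin d → Type*) [MeasurableSpace U]
      [∀ i, MeasurableSpace (L i)] [∀ i, Fintype (L i)] (_ : ∀ i, Fintype.card (L i) ≤ 2 ^ q)
      (M : NeuralIC.Interface U (∀ i, L i)),
      NeuralIC.capacity M R ≤ ENNReal.ofReal (d * q)) ∧
    -- additive white Gaussian noise with an average power constraint
    (∀ (d : ℕ) (P σ : ℝ), 0 ≤ P → 0 < σ →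
      NeuralIC.capacity (NeuralIC.awgn d P σ) R ≤
        ENNReal.ofReal (d / 2 * Real.logb 2 (1 + P / σ ^ 2))) ∧
    -- an unconstrained real-valued register
    (∀ d : ℕ, 1 ≤ d → NeuralIC.capacity (NeuralIC.realRegister d) R = ⊤) :=
  ⟨fun _ _ _ _ _ M => NeuralIC.capacity_le_logb_card M R,
    fun _ _ _ _ _ _ _ hL M => NeuralIC.capacity_pi_le hL M R,
    fun d _ _ hP hσ => NeuralIC.capacity_awgn_le d hP hσ R,
    fun _ hd => NeuralIC.capacity_realRegister hd R⟩
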